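/- **Notation.** Let $h(x)=\frac1\pi e^{-|x|^2}$ on $\mathbb R^2$. For a radial function $f$ write $f(x)=f_r(|x|)$; let $x^\perp=(x_2,-x_1)$ and let $J_0$ be the Bessel function of the first kind of order $0$. Put $\hat h(s)=\int_0^\infty r\,h_r(r)J_0(rs)\,dr$, $\;Z(r)=\int_0^\infty s\,|2\pi\hat h(s)|^2J_0(s\sqrt r)\,ds$ $(r\ge 0)$, $\;G(x)=-\frac1{2\pi}\int_{\mathbb R^2}\log|x-y|\,h(y)\,dy$ (so $-\Delta G=h$), $\;P_K(r)=-2\pi r\,G_r'(r)$, $\;H_G(r)=-\log r-2\pi G_r(r)$, $\;H_P(r)=\log\sqrt r+H_G(\sqrt r)$. **(1) Hypotheses on $h$.** $h\in C^1(\mathbb R^2)\cap W^{1,1}(\mathbb R^2)$ is positive and radial, with $h_r'(r)<0$ for $r>0$ and $\int_{\mathbb R^2}h\,dx=2\pi\int_0^\infty r\,h_r(r)\,dr=1$; the functions $\mathbf 1_{|x|\le1}(1-\log|x|)^{-1}h$, $|x|\nabla h$ and, for some $\eta>0$, $|x|^{3+\eta}h$ are in $L^\infty(\mathbb R^2)$;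 and $\mathbf 1_{|x|>1}|x|h$, $|x|\nabla h$ are in $L^1(\mathbb R^2)$. **(2) The function $Z$.** For every $r\ge0$ the integral defining $Z(r)$ converges absolutely and $Z(r)=e^{-r/2}$; moreover $\frac1{2\pi}Z(|x|^2)=\int_{\mathbb R^2}h(x-y)h(y)\,dy=\frac1{2\pi}e^{-|x|^2/2}$ for all $x\in\mathbb R^2$. The function $Z$ is strictly decreasing and strictly convex on $[0,\infty)$. **(3)** $Z$ and $H_P$ are twice continuously differentiable on $(0,\infty)$ and $Z''(r)H_P'(r)-Z'(r)H_P''(r)>0$ for all $r>0$. **(4) Enstrophy dissipation.** Let $\Gamma_1\ge\Gamma_2>0>\Gamma_3$ with $\frac1{\Gamma_1}+\frac1{\Gamma_2}+\frac1{\Gamma_3}=0$. Put $\psi(r)=\left(\frac1{1+r}\right)^{1/\Gamma_1}\left(\frac r{1+r}\right)^{1/\Gamma_2}$ and $k_\pm=\left(\frac{\Gamma_1+\Gamma_2\pm\sqrt{\Gamma_1^2+\Gamma_1\Gamma_2+\Gamma_2^2}}{\Gamma_2}\right)^2$; let $k_0\in\{k_+,k_-\}$ minimize $\psi(\frac{\Gamma_1}{\Gamma_2}k)$,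 and let $$\frac{\Gamma_1^2\Gamma_2^2}{4\pi(\Gamma_1+\Gamma_2)}\log\frac{\psi(\frac{\Gamma_1}{\Gamma_2}k_0)}{\psi(\frac{\Gamma_1}{\Gamma_2})}<\mathscr H_c<0 .$$ For $\varepsilon>0$ consider the regularized three-vortex system $$\dot x_n=-\frac1{2\pi}\sum_{m\ne n}\Gamma_m\frac{(x_n-x_m)^\perp}{|x_n-x_m|^2}\,P_K\!\left(\frac{|x_n-x_m|}{\varepsilon}\right)\qquad(n=1,2,3),$$ where the summand is $0$ if $x_n=x_m$. Let $X=(X_1,X_2,X_3)$ be a solution on $\mathbb R$ of this system with $\varepsilon=1$, with pairwise distinct initial points and with $-\frac1{2\pi}\sum_{n<m}\Gamma_n\Gamma_mH_P(L_{mn}(0)^2)=\mathscr H_c$, where $L_{mn}=|X_m-X_n|$. Assume that neither as $t\to+\infty$ nor as $t\to-\infty$ do the distances $(L_{mn}(t))$ converge to the distances of a relative equilibrium (a solution of the system with $\varepsilon=1$, coincident points allowed, whose mutual distances are constant in time), and that the distances $(L_{mn}(t))$ are not periodic in $t$. Put $$\mathscr Z_0(\tau)=-\frac1{2\pi}\sum_{n<m}\Gamma_n\Gamma_m\,Z(L_{mn}(\tau)^2).$$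 Then $\mathscr Z_0$ is integrable on $\mathbb R$ and $z_0=\int_{\mathbb R}\mathscr Z_0\,d\tau>0$. Moreover, for every $t^*\in\mathbb R$, the functions $x_n^\varepsilon(t)=\varepsilon X_n\!\left(\frac{t-t^*}{\varepsilon^2}\right)$ solve the system with parameter $\varepsilon$ for every $\varepsilon>0$; $|x_m^\varepsilon(t^*)-x_n^\varepsilon(t^*)|\to0$ as $\varepsilon\to0^+$; and the variational part of the enstrophy $$\mathscr Z^\varepsilon(t)=\frac1{2\pi\varepsilon^2}\sum_{n<m}\Gamma_n\Gamma_m\int_0^\infty s\,|2\pi\hat h(s)|^2J_0\!\left(s\,\frac{|x_m^\varepsilon(t)-x_n^\varepsilon(t)|}{\varepsilon}\right)ds$$ is continuous in $t$ and converges to $-z_0\,\delta(\cdot-t^*)$ in the sense of distributions as $\varepsilon\to0^+$. Thus enstrophy is dissipated at the collapse. -/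

import Mathlib

open MeasureTheory Set Filter Topology
open scoped ENNReal ContDiff

noncomputable section

namespace EulerPoincare

/-- The Euclidean plane. -/
abbrev Plane : Type := EuclideanSpace ℝ (Fin 2)

/-- `x^⊥ = (x₂, -x₁)`. -/
def perp (x : Plane) : Plane := !₂[x 1, -x 0]

/-- The radial profile `f_r` of a radial function: `f_r(r) = f(r, 0)`, so `f x = f_r ‖x‖`. -/
def profile (f : Plane → ℝ) (r : ℝ) : ℝ := f !₂[r, 0]

/-- The Bessel function of the first kind of order zero (Bessel's integral). -/
def besselJ0 (x : ℝ) : ℝ :=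
  1 / (2 * Real.pi) * ∫ θ in (-Real.pi)..Real.pi, Real.cos (x * Real.cos θ)

/-- The weight `χ_log⁻`. -/
def chiLogMinus (x : Plane) : ℝ := if ‖x‖ ≤ 1 then (1 - Real.log ‖x‖)⁻¹ else 0

/-- The weight `χ_α⁺`. -/
def chiPlus (α : ℝ) (x : Plane) : ℝ := if ‖x‖ ≤ 1 then 0 else ‖x‖ ^ α

/-- The weight `χ_α`. -/
def chi (α : ℝ) (x : Plane) : ℝ := ‖x‖ ^ α

/-- The conditions on the smoothing function `h` under which the enstrophy variation of three
regularized point vortices is studied (they include those of the well-posedness theory,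
`h ∈ W^{1,1}` and `χ_1⁺ h ∈ L¹`). -/
structure SmoothingHypotheses (h : Plane → ℝ) : Prop where
  contDiff : ContDiff ℝ 1 h
  pos : ∀ x, 0 < h x
  radial : ∀ x y, ‖x‖ = ‖y‖ → h x = h y
  integrable : Integrable h
  integrable_gradient : Integrable (gradient h)
  integrable_chiPlus : Integrable (fun x => chiPlus 1 x * h x)
  chiLogMinus_bounded : MemLp (fun x => chiLogMinus x * h x) ∞ volume
  chi_gradient_bounded : MemLp (fun x => chi 1 x • gradient h x) ∞ volume
  chi_gradient_integrable : Integrable (fun x => chi 1 x • gradient h x)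
  chi_bounded : ∃ η : ℝ, 0 < η ∧ MemLp (fun x => chi (3 + η) x * h x) ∞ volume
  integral_eq_one : ∫ x, h x = 1
  radial_integral_eq_one : 2 * Real.pi * ∫ r in Ioi (0 : ℝ), r * profile h r = 1
  deriv_profile_neg : ∀ r : ℝ, 0 < r → deriv (profile h) r < 0

/-- The Gaussian smoothing function. -/
def gaussianKernel (x : Plane) : ℝ := Real.exp (-‖x‖ ^ 2) / Real.pi

/-! ### Functions derived from the smoothing function -/

/-- The Hankel transform `ĥ(s) = ∫₀^∞ r h_r(r) J₀(r s) dr`. -/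
def hankel (h : Plane → ℝ) (s : ℝ) : ℝ :=
  ∫ r in Ioi (0 : ℝ), r * profile h r * besselJ0 (r * s)

/-- The integrand `s |2π ĥ(s)|² J₀(s L)`. -/
def enstrophyIntegrand (h : Plane → ℝ) (L s : ℝ) : ℝ :=
  s * |2 * Real.pi * hankel h s| ^ 2 * besselJ0 (s * L)

/-- `∫₀^∞ s |2π ĥ(s)|² J₀(s L) ds`. -/
def enstrophyIntegral (h : Plane → ℝ) (L : ℝ) : ℝ :=
  ∫ s in Ioi (0 : ℝ), enstrophyIntegrand h L s

/-- `Z(r) = ∫₀^∞ s |2π ĥ(s)|² J₀(s √r) ds`. -/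
def funZ (h : Plane → ℝ) (r : ℝ) : ℝ := enstrophyIntegral h (Real.sqrt r)

/-- The logarithmic potential `G¹`, the solution of `-Δ G¹ = h`. -/
def potential (h : Plane → ℝ) (x : Plane) : ℝ :=
  -(1 / (2 * Real.pi)) * ∫ y, Real.log ‖x - y‖ * h y

/-- `P_K(r) = -2π r (G_r¹)'(r)`. -/
def funPK (h : Plane → ℝ) (r : ℝ) : ℝ := -2 * Real.pi * r * deriv (profile (potential h)) r

/-- `H_G(r) = -log r - 2π G_r¹(r)`. -/
def funHG (h : Plane → ℝ) (r : ℝ) : ℝ := -Real.log r - 2 * Real.pi * profile (potential h) r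

/-- `H_P(r) = log √r + H_G(√r)`. -/
def funHP (h : Plane → ℝ) (r : ℝ) : ℝ := Real.log (Real.sqrt r) + funHG h (Real.sqrt r)

/-! ### The Euler-Poincaré point vortex system -/

/-- Global-in-time solutions of the point vortex system with regularization parameter `ε`,
`dx_n/dt = -(1/2π) ∑_{m ≠ n} Γ_m (x_n - x_m)^⊥ / l_{mn}² · P_K(l_{mn}/ε)`.
(For coincident points the summand is `0`, in accordance with `K^ε(0) = 0`.) -/
def IsSolution (h : Plane → ℝ) (ε : ℝ) {N : ℕ} (Γ : Fin N → ℝ) (x : Fin N → ℝ → Plane) : Prop :=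
  ∀ n t, HasDerivAt (x n)
    (-(1 / (2 * Real.pi)) • ∑ m ∈ Finset.univ.erase n,
      (Γ m / dist (x m t) (x n t) ^ 2 * funPK h (dist (x m t) (x n t) / ε)) •
        perp (x n t - x m t)) t

/-- The Hamiltonian of the system with `ε = 1`,
`-(1/2π) ∑_{n < m} Γ_n Γ_m H_P(L_{mn}²)`. -/
def hamiltonian (h : Plane → ℝ) {N : ℕ} (Γ : Fin N → ℝ) (X : Fin N → Plane) : ℝ :=
  -(1 / (2 * Real.pi)) * ∑ n, ∑ m ∈ Finset.Ioi n, Γ n * Γ m * funHP h (dist (X m) (X n) ^ 2)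

/-- The variational part of the enstrophy,
`𝒵^ε(t) = 1/(2π ε²) ∑_{n < m} Γ_n Γ_m ∫₀^∞ s |2π ĥ(s)|² J₀(s l_{mn}(t)/ε) ds`. -/
def enstrophyVariation (h : Plane → ℝ) (ε : ℝ) {N : ℕ} (Γ : Fin N → ℝ) (x : Fin N → ℝ → Plane)
    (t : ℝ) : ℝ :=
  1 / (2 * Real.pi * ε ^ 2) * ∑ n, ∑ m ∈ Finset.Ioi n,
    Γ n * Γ m * enstrophyIntegral h (dist (x m t) (x n t) / ε)

/-- `𝒵₀(τ) = -(1/2π) ∑_{n < m} Γ_n Γ_m ∫₀^∞ s |2π ĥ(s)|² J₀(s L_{mn}(τ)) ds`. -/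
def scaledEnstrophy (h : Plane → ℝ) {N : ℕ} (Γ : Fin N → ℝ) (X : Fin N → ℝ → Plane)
    (τ : ℝ) : ℝ :=
  -(1 / (2 * Real.pi)) * ∑ n, ∑ m ∈ Finset.Ioi n,
    Γ n * Γ m * enstrophyIntegral h (dist (X m τ) (X n τ))

/-- `z₀ = ∫_{-∞}^{∞} 𝒵₀(τ) dτ`. -/
def enstrophyMass (h : Plane → ℝ) {N : ℕ} (Γ : Fin N → ℝ) (X : Fin N → ℝ → Plane) : ℝ :=
  ∫ τ, scaledEnstrophy h Γ X τ

/-- Recovery of the `ε`-point vortices from the scaled variables,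
`x_n^ε(t) = ε X_n((t - t^*)/ε²)`. -/
def unscale (ε tstar : ℝ) {N : ℕ} (X : Fin N → ℝ → Plane) : Fin N → ℝ → Plane :=
  fun n t => ε • X n ((t - tstar) / ε ^ 2)

/-- Along `l` (time to `+∞` or to `-∞`) the mutual distances of `X` converge to those of a relative
equilibrium, that is, of a solution `Y` whose mutual distances are constant in time. -/
def ConvergesToRelativeEquilibrium (h : Plane → ℝ) {N : ℕ} (Γ : Fin N → ℝ)
    (X : Fin N → ℝ → Plane) (l : Filter ℝ) : Prop :=
  ∃ Y : Fin N → ℝ → Plane, IsSolution h 1 Γ Y ∧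
    (∀ m n t, dist (Y m t) (Y n t) = dist (Y m 0) (Y n 0)) ∧
    ∀ m n, Tendsto (fun t => dist (X m t) (X n t)) l (𝓝 (dist (Y m 0) (Y n 0)))

/-- The mutual distances of `X` are periodic in time. -/
def HasPeriodicDistances {N : ℕ} (X : Fin N → ℝ → Plane) : Prop :=
  ∃ T : ℝ, 0 < T ∧ ∀ m n t, dist (X m (t + T)) (X n (t + T)) = dist (X m t) (X n t)

/-! ### The range of the Hamiltonian -/

/-- `ψ(r) = (1/(1+r))^{1/Γ₁} (r/(1+r))^{1/Γ₂}`. -/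
def psi (Γ₁ Γ₂ r : ℝ) : ℝ := (1 / (1 + r)) ^ (1 / Γ₁) * (r / (1 + r)) ^ (1 / Γ₂)

def kPlus (Γ₁ Γ₂ : ℝ) : ℝ := ((Γ₁ + Γ₂ + Real.sqrt (Γ₁ ^ 2 + Γ₁ * Γ₂ + Γ₂ ^ 2)) / Γ₂) ^ 2

def kMinus (Γ₁ Γ₂ : ℝ) : ℝ := ((Γ₁ + Γ₂ - Real.sqrt (Γ₁ ^ 2 + Γ₁ * Γ₂ + Γ₂ ^ 2)) / Γ₂) ^ 2

open Classical in
/-- The one of `k_+`, `k_-` at which `k ↦ ψ(Γ₁ k / Γ₂)` is smaller. -/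
def kZero (Γ₁ Γ₂ : ℝ) : ℝ :=
  if psi Γ₁ Γ₂ (Γ₁ / Γ₂ * kPlus Γ₁ Γ₂) ≤ psi Γ₁ Γ₂ (Γ₁ / Γ₂ * kMinus Γ₁ Γ₂) then kPlus Γ₁ Γ₂
  else kMinus Γ₁ Γ₂

/-- The lower end of the admissible range of the Hamiltonian. -/
def hamiltonianLowerBound (Γ₁ Γ₂ : ℝ) : ℝ :=
  Γ₁ ^ 2 * Γ₂ ^ 2 / (4 * Real.pi * (Γ₁ + Γ₂)) *
    Real.log (psi Γ₁ Γ₂ (Γ₁ / Γ₂ * kZero Γ₁ Γ₂) * (psi Γ₁ Γ₂ (Γ₁ / Γ₂))⁻¹)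

end EulerPoincare

end

open EulerPoincare

/-!
For the Gaussian, a pair of vortices at distance `L` has enstrophy `e^{-L²/2}` and, up to constants,
energy `Ein (L²)`, where `Ein' x = (1 - e⁻ˣ) / x`. When the reciprocals of the circulations sum to
zero, the energy and the moment of inertia become `p Ein x + q Ein y - Ein z` and `p x + q y - z` in
the squared sides `x`, `y`, `z` of the vortex triangle, with `p + q = 1`. Since `e^{-x/2}` is a
convex function of `Ein x`, negative energy makes the enstrophy density positive.

Time reversal combined with reflection of the triangle is a symmetry of the reduced evolution, which
is therefore symmetric about any time at which the triangle is degenerate; two such times would make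
it periodic. Hence the oriented area eventually has a fixed sign, the differences of the sides are
eventually of one sign, and the squared sides are eventually monotone. If one of them has a finite
limit, the triangle converges to a collinear relative equilibrium. Otherwise it expands towards a
limit shape determined by the energy, the area stays bounded away from zero, and `x' ≥ K / x` makes
`e^{-x/2}` integrable. Finally, `ε⁻² 𝒵₀((t - t*) / ε²)` is an approximate identity.
-/

noncomputable section

namespace EulerPoincare

/-! ### The functions `(1 - e⁻ˣ) / x` and its primitive -/

/-- The entire function `x ↦ (1 - e⁻ˣ) / x`, with value `1` at `0`: the factor by which the Gaussian
regularization weakens the point vortex interaction at squared distance `x`. -/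
def expQuotient (x : ℝ) : ℝ := dslope (fun u : ℝ => -Real.exp (-u)) 0 x

theorem expQuotient_of_ne {x : ℝ} (hx : x ≠ 0) : expQuotient x = (1 - Real.exp (-x)) / x := by
  rw [expQuotient, dslope_of_ne _ hx, slope_def_field, neg_zero, Real.exp_zero, sub_zero]
  ring

theorem mul_expQuotient (x : ℝ) : x * expQuotient x = 1 - Real.exp (-x) := by
  rcases eq_or_ne x 0 with rfl | hx
  · simp
  · rw [expQuotient_of_ne hx, mul_div_cancel₀ _ hx]

theorem hasDerivAt_exp_neg (x : ℝ) :
    HasDerivAt (fun u : ℝ => Real.exp (-u)) (-Real.exp (-x)) x := by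
  simpa using (hasDerivAt_neg x).exp

theorem expQuotient_zero : expQuotient 0 = 1 := by
  rw [expQuotient, dslope_same, deriv.fun_neg, (hasDerivAt_exp_neg 0).deriv]
  simp

theorem expQuotient_pos (x : ℝ) : 0 < expQuotient x := by
  rcases lt_trichotomy x 0 with hx | rfl | hx
  · rw [expQuotient_of_ne hx.ne]
    exact div_pos_of_neg_of_neg (by simpa using hx) hx
  · simp [expQuotient_zero]
  · rw [expQuotient_of_ne hx.ne']
    exact div_pos (by simpa using hx) hx

theorem contDiff_expQuotient {n : WithTop ℕ∞} : ContDiff ℝ n expQuotient := by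
  refine contDiff_iff_contDiffAt.2 fun x => ?_
  rcases eq_or_ne x 0 with rfl | hx
  · obtain ⟨p, hp⟩ : AnalyticAt ℝ (fun u : ℝ => -Real.exp (-u)) 0 := by fun_prop
    exact hp.has_fpower_series_dslope_fslope.analyticAt.contDiffAt
  · refine ContDiffAt.congr_of_eventuallyEq
      (ContDiffAt.div (f := fun u => 1 - Real.exp (-u)) (by fun_prop) contDiffAt_id hx) ?_
    filter_upwards [isOpen_ne.mem_nhds hx] with u hu
    exact expQuotient_of_ne hu

theorem continuous_expQuotient : Continuous expQuotient :=
  (contDiff_expQuotient (n := 0)).continuous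

theorem hasDerivAt_expQuotient {x : ℝ} (hx : x ≠ 0) :
    HasDerivAt expQuotient ((Real.exp (-x) - expQuotient x) / x) x := by
  have hquot := ((hasDerivAt_exp_neg x).const_sub 1).div (hasDerivAt_id x) hx
  refine (hquot.congr_of_eventuallyEq ?_).congr_deriv ?_
  · filter_upwards [isOpen_ne.mem_nhds hx] with u hu
    exact expQuotient_of_ne hu
  · rw [expQuotient_of_ne hx, id]
    field_simp

theorem exp_neg_lt_expQuotient {x : ℝ} (hx : 0 < x) : Real.exp (-x) < expQuotient x := by
  have hexp : x + 1 < Real.exp x := Real.add_one_lt_exp hx.ne'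
  rw [expQuotient_of_ne hx.ne', lt_div_iff₀ hx]
  nlinarith [Real.exp_pos (-x), Real.exp_neg x, mul_inv_cancel₀ (Real.exp_pos x).ne']

theorem strictAntiOn_expQuotient : StrictAntiOn expQuotient (Ici 0) := by
  refine strictAntiOn_of_deriv_neg (convex_Ici 0) continuous_expQuotient.continuousOn fun x hx => ?_
  rw [interior_Ici, mem_Ioi] at hx
  rw [(hasDerivAt_expQuotient hx.ne').deriv]
  exact div_neg_of_neg_of_pos (sub_neg.2 (exp_neg_lt_expQuotient hx)) hx

theorem sub_two_add_mul_exp_neg_pos {x : ℝ} (hx : 0 < x) :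
    0 < x - 2 + (x + 2) * Real.exp (-x) := by
  have hderiv : ∀ y : ℝ, HasDerivAt (fun y : ℝ => y - 2 + (y + 2) * Real.exp (-y))
      (1 + (1 * Real.exp (-y) + (y + 2) * -Real.exp (-y))) y := fun y =>
    ((hasDerivAt_id y).sub_const 2).add (((hasDerivAt_id y).add_const 2).mul (hasDerivAt_exp_neg y))
  have hmono : StrictMonoOn (fun y : ℝ => y - 2 + (y + 2) * Real.exp (-y)) (Ici 0) := by
    refine strictMonoOn_of_deriv_pos (convex_Ici 0)
      (fun y _ => (hderiv y).continuousAt.continuousWithinAt) fun y hy => ?_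
    rw [interior_Ici, mem_Ioi] at hy
    rw [(hderiv y).deriv]
    linarith [(mul_lt_mul_of_pos_left (exp_neg_lt_expQuotient hy) hy).trans_eq (mul_expQuotient y)]
  simpa using hmono self_mem_Ici hx.le hx

theorem expQuotient_lt_exp_average {x : ℝ} (hx : 0 < x) :
    expQuotient x < (1 + Real.exp (-x)) / 2 := by
  rw [expQuotient_of_ne hx.ne', div_lt_div_iff₀ hx two_pos]
  linarith [sub_two_add_mul_exp_neg_pos hx]

theorem expQuotient_add_two_mul_deriv_pos {x : ℝ} (hx : 0 < x) :
    0 < expQuotient x + 2 * ((Real.exp (-x) - expQuotient x) / x) := by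
  have hexpand : expQuotient x + 2 * ((Real.exp (-x) - expQuotient x) / x) =
      2 / x * ((1 + Real.exp (-x)) / 2 - expQuotient x) := by
    field_simp
    linarith [mul_expQuotient x]
  rw [hexpand]
  exact mul_pos (by positivity) (sub_pos.2 (expQuotient_lt_exp_average hx))

/-- The entire exponential integral `Ein x = ∫₀ˣ (1 - e⁻ᵘ) / u du`. Up to normalization it is the
pair interaction energy of Gaussian vortices at squared distance `x`. -/
def entireExpIntegral (x : ℝ) : ℝ := ∫ u in (0 : ℝ)..x, expQuotient u

theorem hasDerivAt_entireExpIntegral (x : ℝ) : HasDerivAt entireExpIntegral (expQuotient x) x :=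
  continuous_expQuotient.integral_hasStrictDerivAt 0 x |>.hasDerivAt

theorem continuous_entireExpIntegral : Continuous entireExpIntegral :=
  continuous_iff_continuousAt.2 fun x => (hasDerivAt_entireExpIntegral x).continuousAt

theorem strictMono_entireExpIntegral : StrictMono entireExpIntegral :=
  strictMono_of_deriv_pos fun x => by
    rw [(hasDerivAt_entireExpIntegral x).deriv]
    exact expQuotient_pos x

theorem contDiff_entireExpIntegral : ContDiff ℝ ∞ entireExpIntegral := by
  rw [contDiff_infty_iff_deriv,
    funext fun x => (hasDerivAt_entireExpIntegral x).deriv]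
  exact ⟨fun x => (hasDerivAt_entireExpIntegral x).differentiableAt, contDiff_expQuotient⟩

theorem integrableOn_exp_neg_mul_log :
    IntegrableOn (fun u : ℝ => Real.exp (-u) * Real.log u) (Ioi 0) := by
  have hnear : IntegrableOn (fun u : ℝ => Real.exp (-u) * Real.log u) (Ioc 0 1) := by
    rw [← intervalIntegrable_iff_integrableOn_Ioc_of_le zero_le_one]
    exact intervalIntegral.intervalIntegrable_log'.continuousOn_mul (by fun_prop)
  have hgamma : IntegrableOn (fun u : ℝ => Real.exp (-u) * u) (Ioi 0) := by
    refine (Real.GammaIntegral_convergent two_pos).congr_fun (fun u _ => ?_) measurableSet_Ioi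
    norm_num
  have hfar : IntegrableOn (fun u : ℝ => Real.exp (-u) * Real.log u) (Ioi 1) := by
    refine (hgamma.mono_set (Ioi_subset_Ioi zero_le_one)).mono'
      (by fun_prop : Measurable fun u : ℝ => Real.exp (-u) * Real.log u).aestronglyMeasurable ?_
    refine (ae_restrict_iff' measurableSet_Ioi).2 (ae_of_all _ fun u (hu : 1 < u) => ?_)
    rw [Real.norm_of_nonneg (mul_nonneg (Real.exp_pos _).le (Real.log_nonneg hu.le))]
    gcongr
    exact Real.log_le_self (by linarith)
  rw [← Ioc_union_Ioi_eq_Ioi (zero_le_one (α := ℝ))]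
  exact hnear.union hfar

theorem integral_exp_neg_mul_log {x : ℝ} (hx : 0 ≤ x) :
    ∫ u in (0 : ℝ)..x, Real.exp (-u) * Real.log u =
      (1 - Real.exp (-x)) * Real.log x - entireExpIntegral x := by
  have hcont : Continuous fun u : ℝ => expQuotient u * (u * Real.log u) - entireExpIntegral u :=
    (continuous_expQuotient.mul Real.continuous_mul_log).sub continuous_entireExpIntegral
  have hprimitive : (fun u : ℝ => expQuotient u * (u * Real.log u) - entireExpIntegral u) =
      fun u => (1 - Real.exp (-u)) * Real.log u - entireExpIntegral u := by
    funext u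
    rw [← mul_expQuotient]
    ring
  rw [hprimitive] at hcont
  rw [intervalIntegral.integral_eq_sub_of_hasDerivAt_of_le hx hcont.continuousOn (fun u hu => ?_)
    (intervalIntegral.intervalIntegrable_log'.continuousOn_mul (by fun_prop))]
  · simp [entireExpIntegral]
  · have hu0 : u ≠ 0 := hu.1.ne'
    refine ((((hasDerivAt_exp_neg u).const_sub 1).mul (Real.hasDerivAt_log hu0)).sub
      (hasDerivAt_entireExpIntegral u)).congr_deriv ?_
    rw [← mul_expQuotient]
    field_simp
    ring

/-! ### The exponential integral -/

/-- The exponential integral `E₁ x = ∫ₓ^∞ e⁻ᵘ / u du`, by which `Ein` exceeds the logarithm up to a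
constant. -/
def expIntegral (x : ℝ) : ℝ := ∫ u in Ioi x, Real.exp (-u) / u

theorem exp_neg_div_le {x u : ℝ} (hx : 0 < x) (hu : x ≤ u) :
    Real.exp (-u) / u ≤ Real.exp (-u) / x := by gcongr

theorem integrableOn_exp_neg_div {x : ℝ} (hx : 0 < x) :
    IntegrableOn (fun u : ℝ => Real.exp (-u) / u) (Ioi x) := by
  refine ((integrableOn_exp_neg_Ioi x).div_const x).mono'
    (by fun_prop : Measurable fun u : ℝ => Real.exp (-u) / u).aestronglyMeasurable ?_
  refine (ae_restrict_iff' measurableSet_Ioi).2 (ae_of_all _ fun u (hu : x < u) => ?_)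
  rw [Real.norm_of_nonneg (div_nonneg (Real.exp_pos _).le (hx.trans hu).le)]
  exact exp_neg_div_le hx hu.le

theorem expIntegral_pos {x : ℝ} (hx : 0 < x) : 0 < expIntegral x := by
  have hpos : ∀ u ∈ Ioi x, 0 < Real.exp (-u) / u := fun u hu =>
    div_pos (Real.exp_pos _) (hx.trans hu)
  have hsupp : (Function.support fun u : ℝ => Real.exp (-u) / u) ∩ Ioi x = Ioi x :=
    inter_eq_right.2 fun u hu => (hpos u hu).ne'
  refine (setIntegral_pos_iff_support_of_nonneg_ae
    (ae_restrict_of_forall_mem measurableSet_Ioi fun u hu => (hpos u hu).le)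
    (integrableOn_exp_neg_div hx)).2 ?_
  rw [hsupp, Real.volume_Ioi]
  exact ENNReal.zero_lt_top

theorem expIntegral_le {x : ℝ} (hx : 0 < x) : expIntegral x ≤ Real.exp (-x) / x := by
  rw [← integral_exp_neg_Ioi x, ← integral_div]
  exact setIntegral_mono_on (integrableOn_exp_neg_div hx)
    ((integrableOn_exp_neg_Ioi x).div_const x) measurableSet_Ioi
    fun u (hu : x < u) => exp_neg_div_le hx hu.le

theorem expIntegral_add_le {x d : ℝ} (hx : 0 < x) (hd : 0 ≤ d) :
    expIntegral (x + d) ≤ Real.exp (-d) * expIntegral x := by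
  have hpreserve := measurePreserving_add_right (volume : Measure ℝ) d
  have hembed : MeasurableEmbedding fun u : ℝ => u + d := measurableEmbedding_addRight d
  have hpreimage : (fun u : ℝ => u + d) ⁻¹' Ioi (x + d) = Ioi x := by simp
  have hshift : IntegrableOn (fun u : ℝ => Real.exp (-(u + d)) / (u + d)) (Ioi x) := by
    rw [← hpreimage]
    exact (hpreserve.integrableOn_comp_preimage hembed).2
      (integrableOn_exp_neg_div (add_pos_of_pos_of_nonneg hx hd))
  rw [expIntegral, expIntegral, ← integral_const_mul,
    ← hpreserve.setIntegral_preimage_emb hembed, hpreimage]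
  refine setIntegral_mono_on hshift ((integrableOn_exp_neg_div hx).const_mul _)
    measurableSet_Ioi fun u (hu : x < u) => ?_
  have hu0 : 0 < u := hx.trans hu
  calc Real.exp (-(u + d)) / (u + d) ≤ Real.exp (-(u + d)) / u := by gcongr; linarith
    _ = Real.exp (-d) * (Real.exp (-u) / u) := by rw [neg_add_rev, Real.exp_add]; ring

theorem expIntegral_le_expIntegral {x y : ℝ} (hx : 0 < x) (hxy : x ≤ y) :
    expIntegral y ≤ expIntegral x := by
  have hadd := expIntegral_add_le hx (sub_nonneg.2 hxy)
  rw [add_sub_cancel] at hadd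
  exact hadd.trans (mul_le_of_le_one_left (expIntegral_pos hx).le (by simpa using hxy))

theorem tendsto_expIntegral : Tendsto expIntegral atTop (𝓝 0) := by
  refine squeeze_zero' ?_ ?_ (Real.tendsto_exp_neg_atTop_nhds_zero.div_atTop tendsto_id)
  · filter_upwards [eventually_gt_atTop 0] with x hx using (expIntegral_pos hx).le
  · filter_upwards [eventually_gt_atTop 0] with x hx using expIntegral_le hx

theorem entireExpIntegral_sub_entireExpIntegral {x y : ℝ} (hx : 0 < x) (hy : 0 < y) :
    entireExpIntegral y - entireExpIntegral x =
      (Real.log y + expIntegral y) - (Real.log x + expIntegral x) := by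
  have htail : expIntegral x - expIntegral y = ∫ u in x..y, Real.exp (-u) / u :=
    intervalIntegral.integral_Ioi_sub_Ioi' (integrableOn_exp_neg_div hx)
      (integrableOn_exp_neg_div hy)
  have hpos : ∀ u ∈ uIcc x y, u ≠ 0 := fun u hu => (lt_of_lt_of_le (lt_min hx hy) hu.1).ne'
  have hexp : IntervalIntegrable (fun u : ℝ => Real.exp (-u) / u) volume x y :=
    ContinuousOn.intervalIntegrable
      (ContinuousOn.div (by fun_prop) continuousOn_id hpos)
  have hdiff : entireExpIntegral y - entireExpIntegral x = ∫ u in x..y, expQuotient u :=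
    intervalIntegral.integral_interval_sub_left (continuous_expQuotient.intervalIntegrable _ _)
      (continuous_expQuotient.intervalIntegrable _ _)
  have hsum : (∫ u in x..y, expQuotient u) + ∫ u in x..y, Real.exp (-u) / u = Real.log (y / x) := by
    rw [← intervalIntegral.integral_add (continuous_expQuotient.intervalIntegrable _ _) hexp,
      ← integral_inv_of_pos hx hy]
    refine intervalIntegral.integral_congr fun u hu => ?_
    have := hpos u hu
    simp only [expQuotient_of_ne this]
    field_simp
    ring
  rw [Real.log_div hy.ne' hx.ne'] at hsum
  linarith

theorem tendsto_entireExpIntegral_atTop : Tendsto entireExpIntegral atTop atTop := by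
  refine tendsto_atTop_mono' atTop ?_
    (tendsto_atTop_add_const_right atTop (entireExpIntegral 1 - expIntegral 1)
      Real.tendsto_log_atTop)
  filter_upwards [eventually_gt_atTop 0] with x hx
  have hsub := entireExpIntegral_sub_entireExpIntegral one_pos hx
  rw [Real.log_one] at hsub
  linarith [expIntegral_pos hx]

/-! ### Positivity of the enstrophy density -/

section ConvexFunctionOfFunction

variable {f f' g g' : ℝ → ℝ} {s : Set ℝ}

theorem exists_sub_eq_deriv_div_mul_sub [s.OrdConnected] (hf : ∀ u ∈ s, HasDerivAt f (f' u) u)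
    (hg : ∀ u ∈ s, HasDerivAt g (g' u) u) (hg' : ∀ u ∈ s, 0 < g' u) {a b : ℝ} (ha : a ∈ s)
    (hb : b ∈ s) (hab : a < b) :
    ∃ c ∈ Ioo a b, f b - f a = f' c / g' c * (g b - g a) := by
  have hsub : Icc a b ⊆ s := Set.Icc_subset s ha hb
  obtain ⟨c, hc, hslope⟩ := exists_ratio_hasDerivAt_eq_ratio_slope f f' hab
    (fun u hu => (hf u (hsub hu)).continuousAt.continuousWithinAt)
    (fun u hu => hf u (hsub (Ioo_subset_Icc_self hu))) g g'
    (fun u hu => (hg u (hsub hu)).continuousAt.continuousWithinAt)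
    (fun u hu => hg u (hsub (Ioo_subset_Icc_self hu)))
  have hc' : g' c ≠ 0 := (hg' c (hsub (Ioo_subset_Icc_self hc))).ne'
  refine ⟨c, hc, ?_⟩
  field_simp
  linarith

/-- The supporting line inequality for `f` regarded as a convex function of `g`. -/
theorem add_deriv_div_mul_sub_le [s.OrdConnected] (hf : ∀ u ∈ s, HasDerivAt f (f' u) u)
    (hg : ∀ u ∈ s, HasDerivAt g (g' u) u) (hg' : ∀ u ∈ s, 0 < g' u)
    (hmono : MonotoneOn (fun u => f' u / g' u) s) {u w : ℝ} (hu : u ∈ s) (hw : w ∈ s) :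
    f w + f' w / g' w * (g u - g w) ≤ f u := by
  have hg_mono : StrictMonoOn g s := strictMonoOn_of_deriv_pos (Set.OrdConnected.convex ‹_›)
    (fun v hv => (hg v hv).continuousAt.continuousWithinAt) fun v hv => by
      rw [(hg v (interior_subset hv)).deriv]
      exact hg' v (interior_subset hv)
  rcases lt_trichotomy u w with huw | rfl | hwu
  · obtain ⟨c, hc, hslope⟩ := exists_sub_eq_deriv_div_mul_sub hf hg hg' hu hw huw
    have hcs : c ∈ s := Set.Icc_subset s hu hw (Ioo_subset_Icc_self hc)
    nlinarith [hmono hcs hw hc.2.le, hg_mono hu hw huw]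
  · simp
  · obtain ⟨c, hc, hslope⟩ := exists_sub_eq_deriv_div_mul_sub hf hg hg' hw hu hwu
    have hcs : c ∈ s := Set.Icc_subset s hw hu (Ioo_subset_Icc_self hc)
    nlinarith [hmono hw hcs hc.1.le, hg_mono hw hu hwu]

end ConvexFunctionOfFunction

theorem hasDerivAt_exp_neg_half (u : ℝ) :
    HasDerivAt (fun v : ℝ => Real.exp (-v / 2)) (-Real.exp (-u / 2) / 2) u :=
  ((hasDerivAt_neg u).div_const 2).exp.congr_deriv (by ring)

theorem monotoneOn_exp_neg_half_div_expQuotient :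
    MonotoneOn (fun u : ℝ => -Real.exp (-u / 2) / 2 / expQuotient u) (Ici 0) := by
  have hderiv : ∀ u : ℝ, 0 < u →
      HasDerivAt (fun u : ℝ => -Real.exp (-u / 2) / 2 / expQuotient u)
        (Real.exp (-u / 2) / 4 * (expQuotient u + 2 * ((Real.exp (-u) - expQuotient u) / u)) /
          expQuotient u ^ 2) u := fun u hu =>
    (((hasDerivAt_exp_neg_half u).neg.div_const 2).div (hasDerivAt_expQuotient hu.ne')
      (expQuotient_pos u).ne').congr_deriv (by simp only [Pi.neg_apply]; ring)
  refine monotoneOn_of_deriv_nonneg (convex_Ici 0) ?_ ?_ ?_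
  · exact ContinuousOn.div (by fun_prop) continuous_expQuotient.continuousOn
      fun u _ => (expQuotient_pos u).ne'
  · intro u hu
    exact (hderiv u (by simpa using hu)).differentiableAt.differentiableWithinAt
  · intro u hu
    rw [interior_Ici, mem_Ioi] at hu
    rw [(hderiv u hu).deriv]
    have := expQuotient_add_two_mul_deriv_pos hu
    positivity

theorem exp_neg_half_tangent_le {u w : ℝ} (hu : 0 ≤ u) (hw : 0 ≤ w) :
    Real.exp (-w / 2) + -Real.exp (-w / 2) / 2 / expQuotient w *
      (entireExpIntegral u - entireExpIntegral w) ≤ Real.exp (-u / 2) :=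
  add_deriv_div_mul_sub_le (s := Ici 0) (fun v _ => hasDerivAt_exp_neg_half v)
    (fun v _ => hasDerivAt_entireExpIntegral v) (fun v _ => expQuotient_pos v)
    monotoneOn_exp_neg_half_div_expQuotient hu hw

theorem exp_neg_half_average_pos {p q x y z : ℝ} (hp : 0 < p) (hq : 0 < q) (hpq : p + q = 1)
    (hx : 0 ≤ x) (hy : 0 ≤ y)
    (henergy : p * entireExpIntegral x + q * entireExpIntegral y < entireExpIntegral z) :
    0 < p * Real.exp (-x / 2) + q * Real.exp (-y / 2) - Real.exp (-z / 2) := by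
  obtain ⟨w, hw, hmean⟩ :
      p * entireExpIntegral x + q * entireExpIntegral y ∈ entireExpIntegral '' uIcc x y :=
    intermediate_value_uIcc continuous_entireExpIntegral.continuousOn
      (convex_uIcc _ _ left_mem_uIcc right_mem_uIcc hp.le hq.le hpq)
  have hw0 : 0 ≤ w := (le_min hx hy).trans hw.1
  have hwz : w < z := strictMono_entireExpIntegral.lt_iff_lt.1 (hmean.trans_lt henergy)
  have hexp : Real.exp (-z / 2) < Real.exp (-w / 2) := Real.exp_lt_exp.2 (by linarith)
  have htangent_x := mul_le_mul_of_nonneg_left (exp_neg_half_tangent_le hx hw0) hp.le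
  have htangent_y := mul_le_mul_of_nonneg_left (exp_neg_half_tangent_le hy hw0) hq.le
  obtain rfl : q = 1 - p := by linarith
  linear_combination hexp + htangent_x + htangent_y +
    (-Real.exp (-w / 2) / 2 / expQuotient w) * hmean

/-! ### Gaussian integrals -/

section Gaussian

variable {V : Type*} [NormedAddCommGroup V] [InnerProductSpace ℝ V] {a : ℝ}

theorem re_cexp_neg_mul_sq_norm_add_inner (a : ℝ) (v w : V) :
    (Complex.exp (-(a : ℂ) * ‖v‖ ^ 2 + Complex.I * (inner ℝ w v : ℝ))).re =
      Real.exp (-a * ‖v‖ ^ 2) * Real.cos (inner ℝ w v) := by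
  have hreal : -(a : ℂ) * ‖v‖ ^ 2 = ((-a * ‖v‖ ^ 2 : ℝ) : ℂ) := by push_cast; rfl
  rw [hreal, Complex.exp_add, ← Complex.ofReal_exp, mul_comm Complex.I, Complex.re_ofReal_mul,
    Complex.exp_ofReal_mul_I_re]

variable [FiniteDimensional ℝ V] [MeasurableSpace V] [BorelSpace V]

theorem integrable_exp_neg_mul_sq_norm_mul_cos (ha : 0 < a) (w : V) :
    Integrable fun v : V => Real.exp (-a * ‖v‖ ^ 2) * Real.cos (inner ℝ w v) := by
  simpa only [← re_cexp_neg_mul_sq_norm_add_inner] using!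
    (GaussianFourier.integrable_cexp_neg_mul_sq_norm_add (b := (a : ℂ)) (by simpa using ha)
      Complex.I w).re

theorem integral_exp_neg_mul_sq_norm_mul_cos (ha : 0 < a) (w : V) :
    ∫ v : V, Real.exp (-a * ‖v‖ ^ 2) * Real.cos (inner ℝ w v) =
      (Real.pi / a) ^ (Module.finrank ℝ V / 2 : ℝ) * Real.exp (-‖w‖ ^ 2 / (4 * a)) := by
  have ha' : 0 < (a : ℂ).re := by simpa using ha
  have hre := integral_re (GaussianFourier.integrable_cexp_neg_mul_sq_norm_add ha' Complex.I w)
  rw [GaussianFourier.integral_cexp_neg_mul_sq_norm_add ha'] at hre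
  have hvalue : ((Real.pi : ℂ) / a) ^ (Module.finrank ℝ V / 2 : ℂ) *
      Complex.exp (Complex.I ^ 2 * ‖w‖ ^ 2 / (4 * a)) =
      (((Real.pi / a) ^ (Module.finrank ℝ V / 2 : ℝ) * Real.exp (-‖w‖ ^ 2 / (4 * a)) : ℝ) : ℂ) := by
    rw [Complex.ofReal_mul, Complex.ofReal_cpow (by positivity), Complex.I_sq]
    push_cast
    ring_nf
  simpa only [hvalue, ← re_cexp_neg_mul_sq_norm_add_inner] using! hre

theorem integrable_exp_neg_mul_sq_norm (ha : 0 < a) :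
    Integrable fun v : V => Real.exp (-a * ‖v‖ ^ 2) := by
  simpa using integrable_exp_neg_mul_sq_norm_mul_cos ha (0 : V)

theorem exists_pow_mul_exp_neg_sq_le (n : ℕ) : ∃ C : ℝ, 0 < C ∧ ∀ t : ℝ, 0 ≤ t →
    t ^ n * Real.exp (-t ^ 2) ≤ C * Real.exp (-(1 / 2) * t ^ 2) := by
  refine ⟨n.factorial * Real.exp (1 / 2), by positivity, fun t ht => ?_⟩
  have hpow : t ^ n ≤ n.factorial * Real.exp t :=
    (div_le_iff₀' (by positivity)).1 (Real.pow_div_factorial_le_exp t ht n)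
  have hexp : Real.exp t * Real.exp (-t ^ 2) ≤ Real.exp (1 / 2) * Real.exp (-(1 / 2) * t ^ 2) := by
    rw [← Real.exp_add, ← Real.exp_add]
    exact Real.exp_le_exp.2 (by nlinarith [sq_nonneg (t - 1)])
  calc t ^ n * Real.exp (-t ^ 2) ≤ n.factorial * Real.exp t * Real.exp (-t ^ 2) := by gcongr
    _ = n.factorial * (Real.exp t * Real.exp (-t ^ 2)) := by ring
    _ ≤ n.factorial * (Real.exp (1 / 2) * Real.exp (-(1 / 2) * t ^ 2)) := by gcongr
    _ = _ := by ring

theorem integrable_norm_pow_mul_exp_neg_sq_norm (n : ℕ) :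
    Integrable fun v : V => ‖v‖ ^ n * Real.exp (-‖v‖ ^ 2) := by
  obtain ⟨C, -, hC⟩ := exists_pow_mul_exp_neg_sq_le n
  refine ((integrable_exp_neg_mul_sq_norm (V := V) one_half_pos).const_mul C).mono'
    (by fun_prop) (ae_of_all _ fun v => ?_)
  rw [Real.norm_of_nonneg (by positivity)]
  exact hC _ (norm_nonneg v)

end Gaussian

theorem integral_exp_neg_mul_sq_norm_plane {a : ℝ} (ha : 0 < a) :
    ∫ x : Plane, Real.exp (-a * ‖x‖ ^ 2) = Real.pi / a := by
  simpa using GaussianFourier.integral_rexp_neg_mul_sq_norm (V := Plane) ha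

/-! ### Integration in polar coordinates -/

/-- The point of the plane with polar coordinates `r` and `θ`. -/
def polarPoint (r θ : ℝ) : Plane := !₂[r * Real.cos θ, r * Real.sin θ]

theorem norm_polarPoint {r : ℝ} (hr : 0 ≤ r) (θ : ℝ) : ‖polarPoint r θ‖ = r := by
  rw [EuclideanSpace.norm_eq, Fin.sum_univ_two]
  simp only [polarPoint, Matrix.cons_val_zero, Matrix.cons_val_one, Real.norm_eq_abs, sq_abs]
  rw [mul_pow, mul_pow, ← mul_add, Real.cos_sq_add_sin_sq, mul_one, Real.sqrt_sq hr]

/-- The identification of `ℝ × ℝ` with the plane. -/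
def planeEquiv : ℝ × ℝ ≃ᵐ Plane :=
  (MeasurableEquiv.finTwoArrow (α := ℝ)).symm.trans (MeasurableEquiv.toLp 2 (Fin 2 → ℝ))

theorem measurePreserving_planeEquiv : MeasurePreserving planeEquiv :=
  (PiLp.volume_preserving_toLp (Fin 2)).comp (volume_preserving_finTwoArrow ℝ).symm

section Polar

variable {E : Type*} [NormedAddCommGroup E] [NormedSpace ℝ E]

theorem integrableOn_comp_polarCoord_symm {f : ℝ × ℝ → E} (hf : Integrable f) :
    IntegrableOn (fun p => p.1 • f (polarCoord.symm p)) polarCoord.target := by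
  have himage : IntegrableOn f (polarCoord.symm '' polarCoord.target) := hf.integrableOn
  rw [integrableOn_image_iff_integrableOn_abs_det_fderiv_smul volume
    polarCoord.open_target.measurableSet
    (fun p _ => (hasFDerivAt_polarCoord_symm p).hasFDerivWithinAt) polarCoord.symm.injOn] at himage
  refine himage.congr_fun (fun p hp => ?_) polarCoord.open_target.measurableSet
  simp only [det_fderivPolarCoordSymm, abs_of_pos (show 0 < p.1 from hp.1)]

variable {f : Plane → E}

theorem integrableOn_smul_comp_polarPoint (hf : Integrable f) :
    IntegrableOn (fun p : ℝ × ℝ => p.1 • f (polarPoint p.1 p.2))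
      (Ioi 0 ×ˢ Ioo (-Real.pi) Real.pi) :=
  integrableOn_comp_polarCoord_symm (measurePreserving_planeEquiv.integrable_comp_of_integrable hf)

theorem integral_smul_comp_polarPoint_eq_setIntegral (r : ℝ) :
    ∫ θ in (-Real.pi)..Real.pi, r • f (polarPoint r θ) =
      ∫ θ in Ioo (-Real.pi) Real.pi, r • f (polarPoint r θ) := by
  rw [intervalIntegral.integral_of_le (by linarith [Real.pi_pos]), integral_Ioc_eq_integral_Ioo]

theorem integrableOn_integral_polarPoint (hf : Integrable f) :
    IntegrableOn (fun r => ∫ θ in (-Real.pi)..Real.pi, r • f (polarPoint r θ)) (Ioi 0) := by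
  have hprod := integrableOn_smul_comp_polarPoint hf
  rw [IntegrableOn, Measure.volume_eq_prod, ← Measure.prod_restrict] at hprod
  simp only [integral_smul_comp_polarPoint_eq_setIntegral]
  exact hprod.integral_prod_left

theorem integral_eq_integral_polarPoint (hf : Integrable f) :
    ∫ x, f x = ∫ r in Ioi (0 : ℝ), ∫ θ in (-Real.pi)..Real.pi, r • f (polarPoint r θ) := by
  simp only [integral_smul_comp_polarPoint_eq_setIntegral]
  calc ∫ x, f x = ∫ p, f (planeEquiv p) :=
        (measurePreserving_planeEquiv.integral_comp planeEquiv.measurableEmbedding f).symm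
    _ = ∫ p in Ioi 0 ×ˢ Ioo (-Real.pi) Real.pi, p.1 • f (polarPoint p.1 p.2) :=
        (integral_comp_polarCoord_symm fun p => f (planeEquiv p)).symm
    _ = _ := setIntegral_prod _ (integrableOn_smul_comp_polarPoint hf)

end Polar

/-! ### The Hankel transform of a Gaussian -/

theorem integral_polarPoint_exp_neg_mul_cos {r : ℝ} (hr : 0 ≤ r) (a b : ℝ) :
    ∫ θ in (-Real.pi)..Real.pi, r • (Real.exp (-a * ‖polarPoint r θ‖ ^ 2) *
      Real.cos (inner ℝ (!₂[b, 0] : Plane) (polarPoint r θ))) =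
      2 * Real.pi * (r * Real.exp (-a * r ^ 2) * besselJ0 (r * b)) := by
  have hinner : ∀ θ, inner ℝ (!₂[b, 0] : Plane) (polarPoint r θ) = r * b * Real.cos θ := fun θ => by
    simp [polarPoint, PiLp.inner_apply, Fin.sum_univ_two]
    ring
  simp only [norm_polarPoint hr, hinner, besselJ0, smul_eq_mul, ← mul_assoc,
    intervalIntegral.integral_const_mul]
  field_simp

theorem integrableOn_mul_exp_neg_mul_besselJ0 {a : ℝ} (ha : 0 < a) (b : ℝ) :
    IntegrableOn (fun r => r * Real.exp (-a * r ^ 2) * besselJ0 (r * b)) (Ioi 0) := by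
  have hpolar := (integrableOn_integral_polarPoint
    (integrable_exp_neg_mul_sq_norm_mul_cos ha (!₂[b, 0] : Plane))).congr_fun
    (fun r hr => integral_polarPoint_exp_neg_mul_cos (le_of_lt hr) a b) measurableSet_Ioi
  exact (integrable_const_mul_iff (by simp [Real.pi_ne_zero]) _).1 hpolar

/-- Weber's integral. -/
theorem integral_mul_exp_neg_mul_besselJ0 {a : ℝ} (ha : 0 < a) (b : ℝ) :
    ∫ r in Ioi (0 : ℝ), r * Real.exp (-a * r ^ 2) * besselJ0 (r * b) =
      Real.exp (-b ^ 2 / (4 * a)) / (2 * a) := by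
  have hgauss := integral_exp_neg_mul_sq_norm_mul_cos ha (!₂[b, 0] : Plane)
  have hnorm : ‖(!₂[b, 0] : Plane)‖ ^ 2 = b ^ 2 := by
    rw [EuclideanSpace.norm_sq_eq, Fin.sum_univ_two]; simp
  rw [integral_eq_integral_polarPoint (integrable_exp_neg_mul_sq_norm_mul_cos ha _),
    setIntegral_congr_fun measurableSet_Ioi
      (fun r hr => integral_polarPoint_exp_neg_mul_cos (le_of_lt hr) a b), integral_const_mul,
    hnorm, finrank_euclideanSpace_fin, Nat.cast_ofNat, div_self two_ne_zero,
    Real.rpow_one] at hgauss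
  refine mul_left_cancel₀ Real.two_pi_pos.ne' (hgauss.trans ?_)
  ring

theorem profile_gaussianKernel (r : ℝ) :
    profile gaussianKernel r = Real.exp (-r ^ 2) / Real.pi := by
  have hnorm : ‖(!₂[r, 0] : Plane)‖ ^ 2 = r ^ 2 := by
    rw [EuclideanSpace.norm_sq_eq, Fin.sum_univ_two]; simp
  rw [profile, gaussianKernel, hnorm]

theorem hankel_gaussianKernel (s : ℝ) :
    hankel gaussianKernel s = Real.exp (-s ^ 2 / 4) / (2 * Real.pi) := by
  have hweber := integral_mul_exp_neg_mul_besselJ0 one_pos s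
  calc hankel gaussianKernel s
      = ∫ r in Ioi (0 : ℝ), 1 / Real.pi * (r * Real.exp (-1 * r ^ 2) * besselJ0 (r * s)) := by
        refine setIntegral_congr_fun measurableSet_Ioi fun r _ => ?_
        simp only [profile_gaussianKernel]
        ring_nf
    _ = Real.exp (-s ^ 2 / 4) / (2 * Real.pi) := by
        rw [integral_const_mul, hweber]
        field_simp

theorem enstrophyIntegrand_gaussianKernel (L s : ℝ) :
    enstrophyIntegrand gaussianKernel L s = s * Real.exp (-(1 / 2) * s ^ 2) * besselJ0 (s * L) := by
  rw [enstrophyIntegrand, hankel_gaussianKernel, sq_abs, mul_div_cancel₀ _ (by positivity),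
    ← Real.exp_nat_mul]
  ring_nf

theorem integrableOn_enstrophyIntegrand_gaussianKernel (L : ℝ) :
    IntegrableOn (enstrophyIntegrand gaussianKernel L) (Ioi 0) := by
  simpa only [← enstrophyIntegrand_gaussianKernel] using
    integrableOn_mul_exp_neg_mul_besselJ0 one_half_pos L

theorem enstrophyIntegral_gaussianKernel (L : ℝ) :
    enstrophyIntegral gaussianKernel L = Real.exp (-L ^ 2 / 2) := by
  simp only [enstrophyIntegral, enstrophyIntegrand_gaussianKernel,
    integral_mul_exp_neg_mul_besselJ0 one_half_pos]
  norm_num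

theorem funZ_gaussianKernel {r : ℝ} (hr : 0 ≤ r) :
    funZ gaussianKernel r = Real.exp (-r / 2) := by
  rw [funZ, enstrophyIntegral_gaussianKernel, Real.sq_sqrt hr]

/-! ### The logarithmic potential of the Gaussian -/

theorem gaussianKernel_pos (x : Plane) : 0 < gaussianKernel x :=
  div_pos (Real.exp_pos _) Real.pi_pos

theorem gaussianKernel_le_exp (x : Plane) : gaussianKernel x ≤ Real.exp (-‖x‖ ^ 2) :=
  div_le_self (Real.exp_pos _).le (by linarith [Real.pi_gt_three])

theorem norm_mul_gaussianKernel_le (c : ℝ) (x : Plane) :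
    ‖c * gaussianKernel x‖ ≤ |c| * Real.exp (-‖x‖ ^ 2) := by
  rw [norm_mul, Real.norm_eq_abs, Real.norm_of_nonneg (gaussianKernel_pos x).le]
  exact mul_le_mul_of_nonneg_left (gaussianKernel_le_exp x) (abs_nonneg c)

theorem contDiff_gaussianKernel {n : WithTop ℕ∞} : ContDiff ℝ n gaussianKernel :=
  (contDiff_norm_sq ℝ).neg.exp.div_const _

theorem continuous_gaussianKernel : Continuous gaussianKernel :=
  (contDiff_gaussianKernel (n := 0)).continuous

theorem abs_log_le_indicator_add {t : ℝ} (ht : 0 ≤ t) :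
    |Real.log t| ≤ |(Ioo (0 : ℝ) 1).indicator Real.log t| + t := by
  rcases ht.eq_or_lt with rfl | ht0
  · simp
  rcases lt_or_ge t 1 with ht1 | ht1
  · rw [indicator_of_mem (show t ∈ Ioo (0 : ℝ) 1 from ⟨ht0, ht1⟩)]
    linarith
  · rw [abs_of_nonneg (Real.log_nonneg ht1)]
    linarith [Real.log_le_self ht, abs_nonneg ((Ioo (0 : ℝ) 1).indicator Real.log t)]

theorem integrable_indicator_log_norm :
    Integrable fun x : Plane => (Ioo (0 : ℝ) 1).indicator Real.log ‖x‖ := by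
  have hIoo : IntegrableOn (fun y : ℝ => y * Real.log y) (Ioo 0 1) :=
    Real.continuous_mul_log.integrableOn_Icc.mono_set Ioo_subset_Icc_self
  rw [integrable_fun_norm_addHaar]
  refine (((integrable_indicator_iff measurableSet_Ioo).2 hIoo).congr
    (ae_of_all _ fun y => ?_)).integrableOn
  by_cases hy : y ∈ Ioo (0 : ℝ) 1 <;> simp [hy]

theorem integrable_log_mul_gaussianKernel (x : Plane) :
    Integrable fun y : Plane => Real.log ‖x - y‖ * gaussianKernel y := by
  have hnear : Integrable fun y : Plane => |(Ioo (0 : ℝ) 1).indicator Real.log ‖x - y‖| :=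
    (integrable_indicator_log_norm.abs.comp_sub_left x :)
  have hfar : Integrable fun y : Plane =>
      ‖x‖ * Real.exp (-1 * ‖y‖ ^ 2) + ‖y‖ ^ 1 * Real.exp (-‖y‖ ^ 2) :=
    ((integrable_exp_neg_mul_sq_norm one_pos).const_mul _).add
      (integrable_norm_pow_mul_exp_neg_sq_norm 1)
  have hmeas : Measurable fun y : Plane => Real.log ‖x - y‖ :=
    Real.measurable_log.comp (by fun_prop)
  refine (hnear.add hfar).mono'
    (hmeas.mul continuous_gaussianKernel.measurable).aestronglyMeasurable (ae_of_all _ fun y => ?_)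
  have hexp : Real.exp (-‖y‖ ^ 2) ≤ 1 := Real.exp_le_one_iff.2 (by nlinarith [sq_nonneg ‖y‖])
  calc ‖Real.log ‖x - y‖ * gaussianKernel y‖
      ≤ |Real.log ‖x - y‖| * Real.exp (-‖y‖ ^ 2) := norm_mul_gaussianKernel_le _ y
    _ ≤ (|(Ioo (0 : ℝ) 1).indicator Real.log ‖x - y‖| + (‖x‖ + ‖y‖)) * Real.exp (-‖y‖ ^ 2) := by
        gcongr
        exact (abs_log_le_indicator_add (norm_nonneg _)).trans (by gcongr; exact norm_sub_le x y)
    _ ≤ |(Ioo (0 : ℝ) 1).indicator Real.log ‖x - y‖| +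
        (‖x‖ * Real.exp (-1 * ‖y‖ ^ 2) + ‖y‖ ^ 1 * Real.exp (-‖y‖ ^ 2)) := by
        rw [add_mul, add_mul, neg_one_mul, pow_one]
        gcongr
        exact mul_le_of_le_one_right (abs_nonneg _) hexp

theorem log_add_posLog_inv_mul_eq_log_max {r ρ : ℝ} (hr : 0 ≤ r) (hρ : 0 < ρ) :
    Real.log ρ + Real.posLog (ρ⁻¹ * r) = Real.log (max r ρ) := by
  rcases le_total r ρ with hle | hle
  · have hratio : |ρ⁻¹ * r| ≤ 1 := by
      rw [abs_of_nonneg (by positivity), inv_mul_le_iff₀ hρ]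
      linarith
    rw [max_eq_right hle, (Real.posLog_eq_zero_iff _).2 hratio, add_zero]
  · have hratio : 1 ≤ |ρ⁻¹ * r| := by
      rw [abs_of_nonneg (by positivity), le_inv_mul_iff₀ hρ]
      linarith
    rw [max_eq_left hle, Real.posLog_eq_log hratio, Real.log_mul (by positivity) (by linarith),
      Real.log_inv]
    ring

theorem norm_sub_polarPoint (r ρ θ : ℝ) :
    ‖(!₂[r, 0] : Plane) - polarPoint ρ θ‖ = ‖circleMap 0 ρ θ - r‖ := by
  rw [norm_sub_rev, EuclideanSpace.norm_eq, Fin.sum_univ_two, Complex.norm_def,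
    Complex.normSq_apply]
  simp [polarPoint, circleMap, Complex.exp_re, Complex.exp_im, ← sq, mul_pow]

/-- Newton's theorem for the logarithmic potential of a circle. -/
theorem integral_log_norm_sub_polarPoint {r ρ : ℝ} (hr : 0 ≤ r) (hρ : 0 < ρ) :
    ∫ θ in (-Real.pi)..Real.pi, Real.log ‖(!₂[r, 0] : Plane) - polarPoint ρ θ‖ =
      2 * Real.pi * Real.log (max r ρ) := by
  have haverage := circleAverage_log_norm_sub_const_eq_log_radius_add_posLog (a := (r : ℂ))
    (c := 0) hρ.ne'
  rw [Real.circleAverage_eq_integral_add (-Real.pi), intervalIntegral.integral_comp_add_right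
      (fun θ => Real.log ‖circleMap 0 ρ θ - r‖), zero_sub, norm_neg, Complex.norm_real,
    Real.norm_of_nonneg hr, log_add_posLog_inv_mul_eq_log_max hr hρ, smul_eq_mul, zero_add,
    show 2 * Real.pi + -Real.pi = Real.pi by ring, inv_mul_eq_iff_eq_mul₀ Real.two_pi_pos.ne']
    at haverage
  simpa only [norm_sub_polarPoint] using haverage

theorem integral_exp_neg_mul_log_max {a : ℝ} (ha : 0 ≤ a) :
    ∫ u in Ioi (0 : ℝ), Real.exp (-u) * Real.log (max a u) =
      (∫ u in Ioi (0 : ℝ), Real.exp (-u) * Real.log u) + entireExpIntegral a := by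
  have hexp : IntervalIntegrable (fun u => Real.exp (-u) * Real.log a) volume 0 a :=
    Continuous.intervalIntegrable (by fun_prop) _ _
  have hlog : IntervalIntegrable (fun u => Real.exp (-u) * Real.log u) volume 0 a :=
    intervalIntegral.intervalIntegrable_log'.continuousOn_mul (by fun_prop)
  have hexcess : ∀ u ∈ Ioi (0 : ℝ), Real.exp (-u) * Real.log (max a u) =
      Real.exp (-u) * Real.log u + (Iic a).indicator
        (fun u => Real.exp (-u) * Real.log a - Real.exp (-u) * Real.log u) u := fun u _ => by
    rcases le_or_gt u a with hu | hu
    · rw [indicator_of_mem (mem_Iic.2 hu), max_eq_left hu, add_sub_cancel]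
    · rw [indicator_of_notMem (by simpa using hu), max_eq_right hu.le, add_zero]
  have hexcess_int : IntegrableOn ((Iic a).indicator
      fun u => Real.exp (-u) * Real.log a - Real.exp (-u) * Real.log u) (Ioi 0) := by
    rw [IntegrableOn, integrable_indicator_iff measurableSet_Iic, IntegrableOn,
      Measure.restrict_restrict measurableSet_Iic, inter_comm, Ioi_inter_Iic]
    exact (intervalIntegrable_iff_integrableOn_Ioc_of_le ha).1 (hexp.sub hlog)
  rw [setIntegral_congr_fun measurableSet_Ioi hexcess,
    integral_add integrableOn_exp_neg_mul_log hexcess_int, setIntegral_indicator measurableSet_Iic,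
    Ioi_inter_Iic, ← intervalIntegral.integral_of_le ha, intervalIntegral.integral_sub hexp hlog,
    intervalIntegral.integral_mul_const, intervalIntegral.integral_comp_neg (fun u => Real.exp u),
    integral_exp, integral_exp_neg_mul_log ha, neg_zero, Real.exp_zero, sub_sub_cancel]

theorem integral_two_mul_comp_sq (f : ℝ → ℝ) :
    ∫ t in Ioi (0 : ℝ), 2 * t * f (t ^ 2) = ∫ u in Ioi (0 : ℝ), f u := by
  rw [← integral_comp_rpow_Ioi_of_pos (g := f) (p := 2) (by norm_num)]
  refine setIntegral_congr_fun measurableSet_Ioi fun t _ => ?_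
  norm_num

theorem integral_polarPoint_log_mul_gaussianKernel {r ρ : ℝ} (hr : 0 ≤ r) (hρ : 0 < ρ) :
    ∫ θ in (-Real.pi)..Real.pi, ρ • (Real.log ‖(!₂[r, 0] : Plane) - polarPoint ρ θ‖ *
      gaussianKernel (polarPoint ρ θ)) =
      2 * ρ * (1 / 2 * (Real.exp (-ρ ^ 2) * Real.log (max (r ^ 2) (ρ ^ 2)))) := by
  have hmax : max (r ^ 2) (ρ ^ 2) = max r ρ ^ 2 :=
    ((pow_left_monotoneOn (n := 2)).map_max (mem_Ici.2 hr) (mem_Ici.2 hρ.le)).symm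
  simp only [gaussianKernel, norm_polarPoint hρ.le, smul_eq_mul]
  rw [intervalIntegral.integral_const_mul, intervalIntegral.integral_mul_const,
    integral_log_norm_sub_polarPoint hr hρ, hmax, Real.log_pow]
  push_cast
  field_simp

theorem profile_potential_gaussianKernel {r : ℝ} (hr : 0 ≤ r) :
    profile (potential gaussianKernel) r = -(1 / (4 * Real.pi)) *
      ((∫ u in Ioi (0 : ℝ), Real.exp (-u) * Real.log u) + entireExpIntegral (r ^ 2)) := by
  rw [profile, potential, integral_eq_integral_polarPoint (integrable_log_mul_gaussianKernel _),
    setIntegral_congr_fun measurableSet_Ioi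
      (fun ρ hρ => integral_polarPoint_log_mul_gaussianKernel hr hρ),
    integral_two_mul_comp_sq fun u => 1 / 2 * (Real.exp (-u) * Real.log (max (r ^ 2) u)),
    integral_const_mul, integral_exp_neg_mul_log_max (sq_nonneg r)]
  ring

theorem funHP_gaussianKernel {x : ℝ} (hx : 0 ≤ x) :
    funHP gaussianKernel x =
      ((∫ u in Ioi (0 : ℝ), Real.exp (-u) * Real.log u) + entireExpIntegral x) / 2 := by
  rw [funHP, funHG, profile_potential_gaussianKernel (Real.sqrt_nonneg x), Real.sq_sqrt hx]
  linear_combination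
    ((∫ u in Ioi (0 : ℝ), Real.exp (-u) * Real.log u) + entireExpIntegral x) / 2 *
      mul_inv_cancel₀ Real.pi_ne_zero

theorem funPK_gaussianKernel {r : ℝ} (hr : 0 < r) :
    funPK gaussianKernel r = r ^ 2 * expQuotient (r ^ 2) := by
  have hderiv : HasDerivAt (profile (potential gaussianKernel))
      (-(1 / (4 * Real.pi)) * (expQuotient (r ^ 2) * (2 * r ^ (2 - 1)))) r := by
    refine ((((hasDerivAt_entireExpIntegral (r ^ 2)).comp r (hasDerivAt_pow 2 r)).const_add
      (∫ u in Ioi (0 : ℝ), Real.exp (-u) * Real.log u)).const_mul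
        (-(1 / (4 * Real.pi)))).congr_of_eventuallyEq ?_
    filter_upwards [Ioi_mem_nhds hr] with ρ hρ
    exact profile_potential_gaussianKernel (le_of_lt hρ)
  rw [funPK, hderiv.deriv]
  field_simp
  ring

/-! ### The smoothing hypotheses for the Gaussian -/

section GaussianBound

variable {V F : Type*} [NormedAddCommGroup V] [InnerProductSpace ℝ V] [FiniteDimensional ℝ V]
  [MeasurableSpace V] [BorelSpace V] [NormedAddCommGroup F] {f : V → F} {C : ℝ} {n : ℕ}

theorem integrable_of_norm_le_pow_mul_exp_neg_sq (hf : AEStronglyMeasurable f)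
    (hle : ∀ v, ‖f v‖ ≤ C * (‖v‖ ^ n * Real.exp (-‖v‖ ^ 2))) : Integrable f :=
  ((integrable_norm_pow_mul_exp_neg_sq_norm n).const_mul C).mono' hf (ae_of_all _ hle)

theorem memLp_top_of_norm_le_pow_mul_exp_neg_sq (hf : AEStronglyMeasurable f) (hC : 0 ≤ C)
    (hle : ∀ v, ‖f v‖ ≤ C * (‖v‖ ^ n * Real.exp (-‖v‖ ^ 2))) : MemLp f ∞ volume := by
  obtain ⟨B, hB, hpow⟩ := exists_pow_mul_exp_neg_sq_le n
  refine memLp_top_of_bound hf (C * B) (ae_of_all _ fun v => (hle v).trans ?_)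
  gcongr
  exact (hpow _ (norm_nonneg v)).trans
    (mul_le_of_le_one_right hB.le (Real.exp_le_one_iff.2 (by nlinarith [sq_nonneg ‖v‖])))

end GaussianBound

theorem gradient_gaussianKernel :
    gradient gaussianKernel = fun x => -(2 * gaussianKernel x) • x := by
  refine gradient_eq fun x => ?_
  rw [hasGradientAt_iff_hasFDerivAt]
  convert! ((hasStrictFDerivAt_norm_sq x).hasFDerivAt.neg.exp).mul_const Real.pi⁻¹ using 1
  ext y
  simp only [gaussianKernel, InnerProductSpace.toDual_apply_apply, inner_smul_left,
    smul_apply, neg_apply, innerSL_apply_apply,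
    smul_eq_mul, nsmul_eq_mul, RCLike.conj_to_real, Pi.neg_apply]
  push_cast
  ring

theorem continuous_gradient_gaussianKernel : Continuous (gradient gaussianKernel) := by
  rw [gradient_gaussianKernel]
  exact (continuous_const.mul continuous_gaussianKernel).neg.smul continuous_id

theorem norm_gradient_gaussianKernel_le (x : Plane) :
    ‖gradient gaussianKernel x‖ ≤ 2 * (‖x‖ ^ 1 * Real.exp (-‖x‖ ^ 2)) := by
  rw [gradient_gaussianKernel, norm_smul, norm_neg,
    Real.norm_of_nonneg (mul_nonneg zero_le_two (gaussianKernel_pos x).le), pow_one, mul_assoc,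
    mul_comm ‖x‖]
  gcongr
  exact gaussianKernel_le_exp x

theorem norm_chi_smul_gradient_gaussianKernel_le (x : Plane) :
    ‖chi 1 x • gradient gaussianKernel x‖ ≤ 2 * (‖x‖ ^ 2 * Real.exp (-‖x‖ ^ 2)) := by
  rw [norm_smul, chi, Real.rpow_one, norm_norm]
  calc ‖x‖ * ‖gradient gaussianKernel x‖
      ≤ ‖x‖ * (2 * (‖x‖ ^ 1 * Real.exp (-‖x‖ ^ 2))) := by
        gcongr
        exact norm_gradient_gaussianKernel_le x
    _ = 2 * (‖x‖ ^ 2 * Real.exp (-‖x‖ ^ 2)) := by ring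

theorem aestronglyMeasurable_chi_smul_gradient_gaussianKernel :
    AEStronglyMeasurable fun x => chi 1 x • gradient gaussianKernel x :=
  (measurable_norm.pow_const 1).aestronglyMeasurable.smul
    continuous_gradient_gaussianKernel.aestronglyMeasurable

theorem integrable_chiPlus_mul_gaussianKernel :
    Integrable fun x => chiPlus 1 x * gaussianKernel x := by
  have hmeas : Measurable (chiPlus 1) := Measurable.ite (measurableSet_le (by fun_prop)
    (by fun_prop)) measurable_const (measurable_norm.pow_const 1)
  refine integrable_of_norm_le_pow_mul_exp_neg_sq (C := 1) (n := 1)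
    (hmeas.mul continuous_gaussianKernel.measurable).aestronglyMeasurable fun x => ?_
  have hchi : |chiPlus 1 x| ≤ ‖x‖ ^ 1 := by
    unfold chiPlus
    split_ifs <;> simp
  rw [one_mul]
  exact (norm_mul_gaussianKernel_le _ x).trans (by gcongr)

theorem memLp_chiLogMinus_mul_gaussianKernel :
    MemLp (fun x => chiLogMinus x * gaussianKernel x) ∞ volume := by
  have hmeas : Measurable chiLogMinus := Measurable.ite (measurableSet_le (by fun_prop)
    (by fun_prop)) (measurable_const.sub (Real.measurable_log.comp measurable_norm)).inv
      measurable_const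
  refine memLp_top_of_norm_le_pow_mul_exp_neg_sq (n := 0)
    (hmeas.mul continuous_gaussianKernel.measurable).aestronglyMeasurable zero_le_one fun x => ?_
  have hchi : |chiLogMinus x| ≤ 1 := by
    unfold chiLogMinus
    split_ifs with hx
    · have hlog := Real.log_nonpos (norm_nonneg x) hx
      rw [abs_inv, abs_of_nonneg (by linarith)]
      exact inv_le_one_of_one_le₀ (by linarith)
    · simp
  rw [pow_zero, one_mul]
  exact (norm_mul_gaussianKernel_le _ x).trans (by gcongr)

theorem memLp_chi_four_mul_gaussianKernel :
    MemLp (fun x => chi (3 + 1) x * gaussianKernel x) ∞ volume := by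
  refine memLp_top_of_norm_le_pow_mul_exp_neg_sq (n := 4)
    ((measurable_norm.pow_const _).mul continuous_gaussianKernel.measurable).aestronglyMeasurable
    zero_le_one fun x => (norm_mul_gaussianKernel_le _ x).trans_eq ?_
  rw [chi, show (3 + 1 : ℝ) = (4 : ℕ) by norm_num, Real.rpow_natCast, one_mul,
    abs_of_nonneg (by positivity)]

theorem integral_gaussianKernel : ∫ x, gaussianKernel x = 1 := by
  have hgauss := integral_exp_neg_mul_sq_norm_plane one_pos
  simp only [neg_one_mul, div_one] at hgauss
  simp only [gaussianKernel, integral_div, hgauss, div_self Real.pi_ne_zero]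

theorem besselJ0_zero : besselJ0 0 = 1 := by
  simp only [besselJ0, zero_mul, Real.cos_zero, intervalIntegral.integral_const, smul_eq_mul]
  field_simp
  norm_num

theorem two_pi_mul_integral_mul_profile_gaussianKernel :
    2 * Real.pi * ∫ r in Ioi (0 : ℝ), r * profile gaussianKernel r = 1 := by
  have hweber : ∫ r in Ioi (0 : ℝ), r * Real.exp (-r ^ 2) = 1 / 2 := by
    simpa [besselJ0_zero] using integral_mul_exp_neg_mul_besselJ0 one_pos 0
  simp only [profile_gaussianKernel, ← mul_div_assoc, integral_div, hweber]
  field_simp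

theorem deriv_profile_gaussianKernel (r : ℝ) :
    deriv (profile gaussianKernel) r = -(2 * r * Real.exp (-r ^ 2)) / Real.pi := by
  rw [funext profile_gaussianKernel]
  have hderiv := (hasDerivAt_pow 2 r).neg.exp.div_const Real.pi
  refine hderiv.deriv.trans ?_
  norm_num
  ring

theorem smoothingHypotheses_gaussianKernel : SmoothingHypotheses gaussianKernel where
  contDiff := contDiff_gaussianKernel
  pos := gaussianKernel_pos
  radial x y hxy := by rw [gaussianKernel, gaussianKernel, hxy]
  integrable := integrable_of_norm_le_pow_mul_exp_neg_sq (C := 1) (n := 0)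
    continuous_gaussianKernel.aestronglyMeasurable fun x => by
      simpa using norm_mul_gaussianKernel_le 1 x
  integrable_gradient := integrable_of_norm_le_pow_mul_exp_neg_sq
    continuous_gradient_gaussianKernel.aestronglyMeasurable norm_gradient_gaussianKernel_le
  integrable_chiPlus := integrable_chiPlus_mul_gaussianKernel
  chiLogMinus_bounded := memLp_chiLogMinus_mul_gaussianKernel
  chi_gradient_bounded := memLp_top_of_norm_le_pow_mul_exp_neg_sq
    aestronglyMeasurable_chi_smul_gradient_gaussianKernel zero_le_two
    norm_chi_smul_gradient_gaussianKernel_le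
  chi_gradient_integrable := integrable_of_norm_le_pow_mul_exp_neg_sq
    aestronglyMeasurable_chi_smul_gradient_gaussianKernel norm_chi_smul_gradient_gaussianKernel_le
  chi_bounded := ⟨1, one_pos, memLp_chi_four_mul_gaussianKernel⟩
  integral_eq_one := integral_gaussianKernel
  radial_integral_eq_one := two_pi_mul_integral_mul_profile_gaussianKernel
  deriv_profile_neg r hr := by
    rw [deriv_profile_gaussianKernel, neg_div]
    exact neg_neg_of_pos (by positivity)

theorem gaussianKernel_sub_mul_gaussianKernel (x y : Plane) :
    gaussianKernel (x - y) * gaussianKernel y = Real.exp (-‖x‖ ^ 2 / 2) / Real.pi ^ 2 *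
      Real.exp (-2 * ‖y - (1 / 2 : ℝ) • x‖ ^ 2) := by
  have hsquare : -‖x - y‖ ^ 2 + -‖y‖ ^ 2 = -‖x‖ ^ 2 / 2 + -2 * ‖y - (1 / 2 : ℝ) • x‖ ^ 2 := by
    rw [norm_sub_sq_real, norm_sub_sq_real, norm_smul, inner_smul_right, real_inner_comm]
    norm_num
    ring
  rw [gaussianKernel, gaussianKernel, div_mul_div_comm, ← Real.exp_add, hsquare, Real.exp_add]
  ring

theorem convolution_gaussianKernel (x : Plane) :
    ∫ y, gaussianKernel (x - y) * gaussianKernel y = Real.exp (-‖x‖ ^ 2 / 2) / (2 * Real.pi) := by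
  simp only [gaussianKernel_sub_mul_gaussianKernel]
  rw [integral_const_mul, integral_sub_right_eq_self (fun z : Plane => Real.exp (-2 * ‖z‖ ^ 2)),
    integral_exp_neg_mul_sq_norm_plane two_pos]
  field_simp

/-! ### The functions `Z` and `H_P` of the Gaussian -/

theorem strictAntiOn_funZ_gaussianKernel : StrictAntiOn (funZ gaussianKernel) (Ici 0) := by
  intro x hx y hy hxy
  rw [funZ_gaussianKernel hx, funZ_gaussianKernel hy]
  exact Real.exp_lt_exp.2 (by linarith)

theorem strictConvexOn_funZ_gaussianKernel :
    StrictConvexOn ℝ (Ici 0) (funZ gaussianKernel) := by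
  refine ⟨convex_Ici 0, fun x hx y hy hxy a b ha hb hab => ?_⟩
  rw [funZ_gaussianKernel hx, funZ_gaussianKernel hy,
    funZ_gaussianKernel (convex_Ici 0 hx hy ha.le hb.le hab)]
  convert strictConvexOn_exp.2 (mem_univ (-x / 2)) (mem_univ (-y / 2))
    (fun h => hxy (by linarith)) ha hb hab using 2
  simp only [smul_eq_mul]
  ring

theorem hasDerivAt_funZ_gaussianKernel {r : ℝ} (hr : 0 < r) :
    HasDerivAt (funZ gaussianKernel) (-Real.exp (-r / 2) / 2) r := by
  refine (hasDerivAt_exp_neg_half r).congr_of_eventuallyEq ?_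
  filter_upwards [Ioi_mem_nhds hr] with x hx
  exact funZ_gaussianKernel (le_of_lt hx)

theorem deriv_deriv_funZ_gaussianKernel {r : ℝ} (hr : 0 < r) :
    deriv (deriv (funZ gaussianKernel)) r = Real.exp (-r / 2) / 4 := by
  have heq : deriv (funZ gaussianKernel) =ᶠ[𝓝 r] fun r => -Real.exp (-r / 2) / 2 := by
    filter_upwards [Ioi_mem_nhds hr] with x hx
    exact (hasDerivAt_funZ_gaussianKernel hx).deriv
  refine heq.deriv_eq.trans (((hasDerivAt_exp_neg_half r).neg.div_const 2).deriv.trans ?_)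
  ring

theorem hasDerivAt_funHP_gaussianKernel {r : ℝ} (hr : 0 < r) :
    HasDerivAt (funHP gaussianKernel) (expQuotient r / 2) r := by
  refine (((hasDerivAt_entireExpIntegral r).const_add
    (∫ u in Ioi (0 : ℝ), Real.exp (-u) * Real.log u)).div_const 2).congr_of_eventuallyEq ?_
  filter_upwards [Ioi_mem_nhds hr] with x hx
  exact funHP_gaussianKernel (le_of_lt hx)

theorem deriv_deriv_funHP_gaussianKernel {r : ℝ} (hr : 0 < r) :
    deriv (deriv (funHP gaussianKernel)) r = (Real.exp (-r) - expQuotient r) / r / 2 := by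
  have heq : deriv (funHP gaussianKernel) =ᶠ[𝓝 r] fun r => expQuotient r / 2 := by
    filter_upwards [Ioi_mem_nhds hr] with x hx
    exact (hasDerivAt_funHP_gaussianKernel hx).deriv
  rw [heq.deriv_eq, ((hasDerivAt_expQuotient hr.ne').div_const 2).deriv]

theorem contDiffOn_funZ_gaussianKernel {n : WithTop ℕ∞} :
    ContDiffOn ℝ n (funZ gaussianKernel) (Ioi 0) := by
  have hexp : ContDiff ℝ n fun r : ℝ => Real.exp (-r / 2) := by fun_prop
  exact hexp.contDiffOn.congr fun r hr => funZ_gaussianKernel (le_of_lt hr)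

theorem contDiffOn_funHP_gaussianKernel :
    ContDiffOn ℝ ∞ (funHP gaussianKernel) (Ioi 0) :=
  ((contDiff_const.add contDiff_entireExpIntegral).div_const 2).contDiffOn.congr
    fun _ hr => funHP_gaussianKernel (le_of_lt hr)

theorem wronskian_funZ_funHP_pos {r : ℝ} (hr : 0 < r) :
    0 < deriv (deriv (funZ gaussianKernel)) r * deriv (funHP gaussianKernel) r
      - deriv (funZ gaussianKernel) r * deriv (deriv (funHP gaussianKernel)) r := by
  rw [deriv_deriv_funZ_gaussianKernel hr, (hasDerivAt_funZ_gaussianKernel hr).deriv,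
    (hasDerivAt_funHP_gaussianKernel hr).deriv, deriv_deriv_funHP_gaussianKernel hr]
  calc 0 < Real.exp (-r / 2) / 8 *
        (expQuotient r + 2 * ((Real.exp (-r) - expQuotient r) / r)) :=
        mul_pos (by positivity) (expQuotient_add_two_mul_deriv_pos hr)
    _ = _ := by ring

/-! ### The reduced three-vortex system -/

/-- The rate of change of twice the oriented area of a triangle of regularized vortices with
circulations `a`, `b`, `c`, in terms of the squared lengths `x`, `y`, `z` of the sides opposite to
them. -/
def areaRate (a b c x y z : ℝ) : ℝ :=
  1 / (2 * Real.pi) * ((a + b + c) * (expQuotient y - expQuotient x) * ((z - x - y) / 2) +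
    a * (expQuotient x * ((z - x - y) / 2) + expQuotient y * y +
      expQuotient z * ((x - y - z) / 2)) -
    b * (expQuotient x * x + expQuotient y * ((z - x - y) / 2) +
      expQuotient z * ((y - x - z) / 2)))

/-- A trajectory of the reduced three-vortex system: `x`, `y`, `z` are the squared distances
opposite to the vortices of circulations `a`, `b`, `c`, and `A` is twice the oriented area. The
circulations have vanishing sum of reciprocals, encoded by the weights `p = -c / a` and
`q = -c / b`; `M` and `e` are the values of the normalized moment of inertia and energy. -/
structure VortexTriangle (a b c p q M e : ℝ) (x y z A : ℝ → ℝ) : Prop where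
  hasDerivAt_x : ∀ t,
    HasDerivAt x (a / Real.pi * A t * (expQuotient (y t) - expQuotient (z t))) t
  hasDerivAt_y : ∀ t,
    HasDerivAt y (b / Real.pi * A t * (expQuotient (z t) - expQuotient (x t))) t
  hasDerivAt_z : ∀ t,
    HasDerivAt z (c / Real.pi * A t * (expQuotient (x t) - expQuotient (y t))) t
  hasDerivAt_A : ∀ t, HasDerivAt A (areaRate a b c (x t) (y t) (z t)) t
  x_nonneg : ∀ t, 0 ≤ x t
  y_nonneg : ∀ t, 0 ≤ y t
  z_nonneg : ∀ t, 0 ≤ z t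
  heron : ∀ t, 4 * A t ^ 2 = 4 * x t * y t - (z t - x t - y t) ^ 2
  moment : ∀ t, p * x t + q * y t - z t = M
  energy : ∀ t,
    p * entireExpIntegral (x t) + q * entireExpIntegral (y t) - entireExpIntegral (z t) = e
  p_pos : 0 < p
  q_pos : 0 < q
  p_add_q : p + q = 1
  c_neg : c < 0
  a_mul_p : a * p = -c
  b_mul_q : b * q = -c
  e_neg : e < 0

/-- The squared distances of a collinear relative equilibrium of three regularized vortices that
are not all at the same point. -/
structure IsCollinearEquilibrium (a b c x y z : ℝ) : Prop where
  x_nonneg : 0 ≤ x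
  y_nonneg : 0 ≤ y
  heron : 4 * x * y = (z - x - y) ^ 2
  areaRate_eq_zero : areaRate a b c x y z = 0
  ne_zero : x ≠ 0 ∨ y ≠ 0

theorem continuous_areaRate (a b c : ℝ) :
    Continuous (fun u : ℝ × ℝ × ℝ => areaRate a b c u.1 u.2.1 u.2.2) := by
  have := continuous_expQuotient
  unfold areaRate
  fun_prop

theorem eq_of_hasDerivAt_of_contDiff {E : Type*} [NormedAddCommGroup E] [NormedSpace ℝ E]
    [FiniteDimensional ℝ E] {v : E → E} (hv : ContDiff ℝ 1 v) {f g : ℝ → E}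
    (hf : ∀ t, HasDerivAt f (v (f t)) t) (hg : ∀ t, HasDerivAt g (v (g t)) t) {t₀ : ℝ}
    (h0 : f t₀ = g t₀) : f = g := by
  funext t
  obtain ⟨α, β, ht, ht₀⟩ : ∃ α β, t ∈ Ioo α β ∧ t₀ ∈ Ioo α β :=
    ⟨min t t₀ - 1, max t t₀ + 1, by grind, by grind⟩
  have hfc : Continuous f := continuous_iff_continuousAt.2 fun t => (hf t).continuousAt
  have hgc : Continuous g := continuous_iff_continuousAt.2 fun t => (hg t).continuousAt
  have hK : IsCompact (f '' Icc α β ∪ g '' Icc α β) :=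
    (isCompact_Icc.image hfc).union (isCompact_Icc.image hgc)
  obtain ⟨R, hR⟩ := hK.isBounded.subset_closedBall 0
  obtain ⟨C, hC⟩ := (hv.contDiffOn (s := Metric.closedBall (0 : E) R)).exists_lipschitzOnWith
    one_ne_zero (convex_closedBall 0 R) (isCompact_closedBall 0 R)
  exact ODE_solution_unique_of_mem_Ioo (v := fun _ => v) (s := fun _ => Metric.closedBall (0 : E) R)
    (fun _ _ => hC) ht₀
    (fun s hs => ⟨hf s, hR (Or.inl (mem_image_of_mem f (Ioo_subset_Icc_self hs)))⟩)
    (fun s hs => ⟨hg s, hR (Or.inr (mem_image_of_mem g (Ioo_subset_Icc_self hs)))⟩) h0 ht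

/-- A function that eventually does not change its sign. -/
def HasEventualSign (u : ℝ → ℝ) : Prop :=
  (∀ᶠ t in atTop, 0 ≤ u t) ∨ ∀ᶠ t in atTop, u t ≤ 0

namespace HasEventualSign

variable {u v u' A : ℝ → ℝ}

theorem const (k : ℝ) : HasEventualSign fun _ => k :=
  (le_total 0 k).imp (fun h => .of_forall fun _ => h) fun h => .of_forall fun _ => h

theorem neg (hu : HasEventualSign u) : HasEventualSign fun t => -u t :=
  hu.symm.imp (fun h => h.mono fun _ => neg_nonneg.2) fun h => h.mono fun _ => neg_nonpos.2

theorem mul (hu : HasEventualSign u) (hv : HasEventualSign v) :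
    HasEventualSign fun t => u t * v t := by
  rcases hu with hu | hu <;> rcases hv with hv | hv
  · exact .inl (by filter_upwards [hu, hv] with t using mul_nonneg)
  · exact .inr (by filter_upwards [hu, hv] with t using mul_nonpos_of_nonneg_of_nonpos)
  · exact .inr (by filter_upwards [hu, hv] with t using mul_nonpos_of_nonpos_of_nonneg)
  · exact .inl (by filter_upwards [hu, hv] with t using mul_nonneg_of_nonpos_of_nonpos)

theorem expQuotient_sub_expQuotient (hu : ∀ t, 0 ≤ u t) (hv : ∀ t, 0 ≤ v t)
    (huv : HasEventualSign fun t => u t - v t) :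
    HasEventualSign fun t => expQuotient (u t) - expQuotient (v t) := by
  refine huv.symm.imp (fun h => ?_) fun h => ?_ <;> filter_upwards [h] with t ht
  · exact sub_nonneg.2 (strictAntiOn_expQuotient.antitoneOn (hu t) (hv t) (sub_nonpos.1 ht))
  · exact sub_nonpos.2 (strictAntiOn_expQuotient.antitoneOn (hv t) (hu t) (sub_nonneg.1 ht))

theorem of_hasDerivAt (hu : ∀ t, HasDerivAt u (u' t) t)
    (h0 : ∀ᶠ t in atTop, u t = 0 → 0 < u' t) : HasEventualSign u := by
  obtain ⟨T, hT⟩ := eventually_atTop.1 h0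
  by_cases h : ∃ s, T ≤ s ∧ 0 ≤ u s
  · obtain ⟨s, hs, hus⟩ := h
    left
    filter_upwards [eventually_ge_atTop s] with t ht
    have hneg := image_le_of_deriv_right_lt_deriv_boundary (f := fun t => -u t)
      (f' := fun t => -u' t) (B := fun _ => 0) (B' := fun _ => 0) (a := s) (b := t)
      (fun r _ => (hu r).neg.continuousAt.continuousWithinAt)
      (fun r _ => (hu r).neg.hasDerivWithinAt) (neg_nonpos.2 hus)
      (fun r => hasDerivAt_const r (0 : ℝ))
      (fun r hr hr0 => neg_neg_of_pos (hT r (hs.trans hr.1) (neg_eq_zero.1 hr0))) ⟨ht, le_rfl⟩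
    exact neg_nonpos.1 hneg
  · push Not at h
    right
    filter_upwards [eventually_ge_atTop T] with t ht using (h t ht).le

end HasEventualSign

theorem eventually_pos_or_eventually_neg {A : ℝ → ℝ} (hA : Continuous A)
    (h0 : ∀ᶠ t in atTop, A t ≠ 0) :
    (∀ᶠ t in atTop, 0 < A t) ∨ ∀ᶠ t in atTop, A t < 0 := by
  obtain ⟨T, hT⟩ := eventually_atTop.1 h0
  by_contra hcon
  simp only [not_or, not_eventually, not_lt] at hcon
  obtain ⟨s, hs, hs'⟩ := (hcon.1.and_eventually (eventually_ge_atTop T)).exists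
  obtain ⟨t, ht, ht'⟩ := (hcon.2.and_eventually (eventually_ge_atTop T)).exists
  obtain ⟨r, hr, hr0⟩ := (isPreconnected_Ici (a := T)).intermediate_value hs' ht'
    hA.continuousOn ⟨hs, ht⟩
  exact hT r hr hr0

namespace HasEventualSign

variable {u u' A : ℝ → ℝ}

theorem of_continuous_of_ne_zero (hA : Continuous A) (h0 : ∀ᶠ t in atTop, A t ≠ 0) :
    HasEventualSign A :=
  (eventually_pos_or_eventually_neg hA h0).imp (fun h => h.mono fun _ => le_of_lt)
    fun h => h.mono fun _ => le_of_lt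

theorem of_hasDerivAt_mul (hA : Continuous A) (hA0 : ∀ᶠ t in atTop, A t ≠ 0)
    (hu : ∀ t, HasDerivAt u (u' t) t) (h0 : ∀ᶠ t in atTop, u t = 0 → 0 < u' t * A t) :
    HasEventualSign u := by
  rcases eventually_pos_or_eventually_neg hA hA0 with h | h
  · refine of_hasDerivAt hu ?_
    filter_upwards [h, h0] with t ht h0 hut using pos_of_mul_pos_left (h0 hut) ht.le
  · have hneg : HasEventualSign fun t => -u t := by
      refine of_hasDerivAt (fun t => (hu t).neg) ?_
      filter_upwards [h, h0] with t ht h0 hut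
      exact neg_pos.2 (neg_of_mul_pos_left (h0 (neg_eq_zero.1 hut)) ht.le)
    simpa only [neg_neg] using hneg.neg

end HasEventualSign

theorem tendsto_or_tendsto_atTop_of_deriv_nonneg {f f' : ℝ → ℝ}
    (hf : ∀ t, HasDerivAt f (f' t) t) (h : ∀ᶠ t in atTop, 0 ≤ f' t) :
    (∃ l, Tendsto f atTop (𝓝 l)) ∨ Tendsto f atTop atTop := by
  obtain ⟨T, hT⟩ := eventually_atTop.1 h
  have hmono : MonotoneOn f (Ici T) := by
    refine monotoneOn_of_deriv_nonneg (convex_Ici T)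
      (fun t _ => (hf t).continuousAt.continuousWithinAt)
      (fun t _ => (hf t).differentiableAt.differentiableWithinAt) fun t ht => ?_
    rw [(hf t).deriv]
    exact hT t (interior_subset ht)
  have hmono' : Monotone fun t => f (max t T) := fun s t hst =>
    hmono (le_max_right s T) (le_max_right t T) (max_le_max_right T hst)
  have heq : (fun t => f (max t T)) =ᶠ[atTop] f := by
    filter_upwards [eventually_ge_atTop T] with t ht using congrArg f (max_eq_left ht)
  exact (tendsto_atTop_of_monotone hmono').symm.imp (fun ⟨l, hl⟩ => ⟨l, hl.congr' heq⟩)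
    fun h => h.congr' heq

theorem tendsto_or_tendsto_atTop {f f' : ℝ → ℝ} (hf : ∀ t, HasDerivAt f (f' t) t)
    (h0 : ∀ t, 0 ≤ f t) (hs : HasEventualSign f') :
    (∃ l, Tendsto f atTop (𝓝 l)) ∨ Tendsto f atTop atTop := by
  rcases hs with hs | hs
  · exact tendsto_or_tendsto_atTop_of_deriv_nonneg hf hs
  · rcases tendsto_or_tendsto_atTop_of_deriv_nonneg (fun t => (hf t).neg)
      (hs.mono fun _ => neg_nonneg.2) with ⟨l, hl⟩ | h
    · exact .inl ⟨-l, by simpa using hl.neg⟩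
    · obtain ⟨t, ht⟩ := (h.eventually_gt_atTop 0).exists
      exact absurd (neg_pos.1 ht) (h0 t).not_gt

theorem eq_zero_of_tendsto_of_tendsto_deriv {f f' : ℝ → ℝ} (hf : ∀ t, HasDerivAt f (f' t) t)
    {l m : ℝ} (hl : Tendsto f atTop (𝓝 l)) (hm : Tendsto f' atTop (𝓝 m)) : m = 0 := by
  have hmean : ∀ t : ℝ, ∃ s ∈ Ioo t (t + 1), f' s = (f (t + 1) - f t) / (t + 1 - t) := fun t =>
    exists_hasDerivAt_eq_slope f f' (lt_add_one t)
      (fun s _ => (hf s).continuousAt.continuousWithinAt) (fun s _ => hf s)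
  choose σ hσ hσ' using hmean
  have hσ_top : Tendsto σ atTop atTop := tendsto_atTop_mono (fun t => (hσ t).1.le) tendsto_id
  have hslope : Tendsto (fun t => (f (t + 1) - f t) / (t + 1 - t)) atTop (𝓝 0) := by
    simpa using (hl.comp (tendsto_atTop_add_const_right atTop (1 : ℝ) tendsto_id)).sub hl
  exact tendsto_nhds_unique ((hm.comp hσ_top).congr hσ') hslope

theorem exists_tendsto_of_tendsto_sq {A : ℝ → ℝ} {l : ℝ} (hA : Continuous A)
    (hA0 : ∀ᶠ t in atTop, A t ≠ 0) (hl : Tendsto (fun t => A t ^ 2) atTop (𝓝 l)) :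
    ∃ k, Tendsto A atTop (𝓝 k) ∧ k ^ 2 = l := by
  have habs : Tendsto (fun t => |A t|) atTop (𝓝 √l) :=
    hl.sqrt.congr fun t => Real.sqrt_sq_eq_abs (A t)
  obtain ⟨k, hk⟩ : ∃ k, Tendsto A atTop (𝓝 k) := by
    rcases eventually_pos_or_eventually_neg hA hA0 with h | h
    · exact ⟨_, habs.congr' (h.mono fun t ht => abs_of_pos ht)⟩
    · exact ⟨_, habs.neg.congr' (h.mono fun t ht => by rw [abs_of_neg ht, neg_neg])⟩
  exact ⟨k, hk, tendsto_nhds_unique (hk.pow 2) hl⟩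

namespace VortexTriangle

variable {a b c p q M e : ℝ} {x y z A : ℝ → ℝ}

theorem a_pos (h : VortexTriangle a b c p q M e x y z A) : 0 < a :=
  pos_of_mul_pos_left (h.a_mul_p ▸ neg_pos.2 h.c_neg) h.p_pos.le

theorem swap (h : VortexTriangle a b c p q M e x y z A) :
    VortexTriangle b a c q p M e y x z (fun t => -A t) where
  hasDerivAt_x t := by convert! h.hasDerivAt_y t using 1; ring
  hasDerivAt_y t := by convert! h.hasDerivAt_x t using 1; ring
  hasDerivAt_z t := by convert! h.hasDerivAt_z t using 1; ring
  hasDerivAt_A t := by convert! (h.hasDerivAt_A t).neg using 1; unfold areaRate; ring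
  x_nonneg := h.y_nonneg
  y_nonneg := h.x_nonneg
  z_nonneg := h.z_nonneg
  heron t := by linarith [h.heron t]
  moment t := by linarith [h.moment t]
  energy t := by linarith [h.energy t]
  p_pos := h.q_pos
  q_pos := h.p_pos
  p_add_q := by rw [add_comm, h.p_add_q]
  c_neg := h.c_neg
  a_mul_p := h.b_mul_q
  b_mul_q := h.a_mul_p
  e_neg := h.e_neg

theorem b_pos (h : VortexTriangle a b c p q M e x y z A) : 0 < b :=
  h.swap.a_pos

theorem reflect (h : VortexTriangle a b c p q M e x y z A) (s : ℝ) :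
    VortexTriangle a b c p q M e (fun t => x (s - t)) (fun t => y (s - t)) (fun t => z (s - t))
      (fun t => -A (s - t)) where
  hasDerivAt_x t := by convert! (h.hasDerivAt_x (s - t)).comp_const_sub s t using 1; ring
  hasDerivAt_y t := by convert! (h.hasDerivAt_y (s - t)).comp_const_sub s t using 1; ring
  hasDerivAt_z t := by convert! (h.hasDerivAt_z (s - t)).comp_const_sub s t using 1; ring
  hasDerivAt_A t := by convert! ((h.hasDerivAt_A (s - t)).comp_const_sub s t).neg using 1; ring
  x_nonneg t := h.x_nonneg _
  y_nonneg t := h.y_nonneg _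
  z_nonneg t := h.z_nonneg _
  heron t := by linarith [h.heron (s - t)]
  moment t := h.moment _
  energy t := h.energy _
  p_pos := h.p_pos
  q_pos := h.q_pos
  p_add_q := h.p_add_q
  c_neg := h.c_neg
  a_mul_p := h.a_mul_p
  b_mul_q := h.b_mul_q
  e_neg := h.e_neg

theorem continuous_x (h : VortexTriangle a b c p q M e x y z A) : Continuous x :=
  continuous_iff_continuousAt.2 fun t => (h.hasDerivAt_x t).continuousAt

theorem continuous_y (h : VortexTriangle a b c p q M e x y z A) : Continuous y :=
  h.swap.continuous_x

theorem continuous_z (h : VortexTriangle a b c p q M e x y z A) : Continuous z :=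
  continuous_iff_continuousAt.2 fun t => (h.hasDerivAt_z t).continuousAt

theorem continuous_A (h : VortexTriangle a b c p q M e x y z A) : Continuous A :=
  continuous_iff_continuousAt.2 fun t => (h.hasDerivAt_A t).continuousAt

theorem eq_of_eq_at {x' y' z' A' : ℝ → ℝ} (h : VortexTriangle a b c p q M e x y z A)
    (h' : VortexTriangle a b c p q M e x' y' z' A') {t₀ : ℝ}
    (h0 : (x t₀, y t₀, z t₀, A t₀) = (x' t₀, y' t₀, z' t₀, A' t₀)) (t : ℝ) :
    (x t, y t, z t, A t) = (x' t, y' t, z' t, A' t) := by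
  let v : ℝ × ℝ × ℝ × ℝ → ℝ × ℝ × ℝ × ℝ := fun u =>
    (a / Real.pi * u.2.2.2 * (expQuotient u.2.1 - expQuotient u.2.2.1),
      b / Real.pi * u.2.2.2 * (expQuotient u.2.2.1 - expQuotient u.1),
      c / Real.pi * u.2.2.2 * (expQuotient u.1 - expQuotient u.2.1),
      areaRate a b c u.1 u.2.1 u.2.2.1)
  have hv : ContDiff ℝ 1 v := by
    have := contDiff_expQuotient (n := 1)
    unfold v areaRate
    fun_prop
  exact congrFun (eq_of_hasDerivAt_of_contDiff hv
    (f := fun t => (x t, y t, z t, A t)) (g := fun t => (x' t, y' t, z' t, A' t))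
    (fun t => (h.hasDerivAt_x t).prodMk ((h.hasDerivAt_y t).prodMk
      ((h.hasDerivAt_z t).prodMk (h.hasDerivAt_A t))))
    (fun t => (h'.hasDerivAt_x t).prodMk ((h'.hasDerivAt_y t).prodMk
      ((h'.hasDerivAt_z t).prodMk (h'.hasDerivAt_A t)))) h0) t

theorem symm_of_area_eq_zero (h : VortexTriangle a b c p q M e x y z A) {s : ℝ} (hs : A s = 0)
    (t : ℝ) : (x (2 * s - t), y (2 * s - t), z (2 * s - t)) = (x t, y t, z t) := by
  have heq := (h.reflect (2 * s)).eq_of_eq_at h (t₀ := s)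
    (by rw [two_mul, add_sub_cancel_right, hs, neg_zero]) t
  simp only [Prod.mk.injEq] at heq ⊢
  exact ⟨heq.1, heq.2.1, heq.2.2.1⟩

theorem periodic_of_area_eq_zero (h : VortexTriangle a b c p q M e x y z A) {s s' : ℝ}
    (hs : A s = 0) (hs' : A s' = 0) :
    Function.Periodic (fun t => (x t, y t, z t)) (2 * (s' - s)) := fun t => by
  have hshift : 2 * s' - (2 * s - t) = t + 2 * (s' - s) := by ring
  have hreflect := h.symm_of_area_eq_zero hs' (2 * s - t)
  rw [hshift] at hreflect
  exact hreflect.trans (h.symm_of_area_eq_zero hs t)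

theorem y_lt_x_of_x_eq_z (h : VortexTriangle a b c p q M e x y z A) {t : ℝ} (hxz : x t = z t) :
    y t < x t := by
  refine strictMono_entireExpIntegral.lt_iff_lt.1 (lt_of_mul_lt_mul_left ?_ h.q_pos.le)
  have hen := h.energy t
  rw [← hxz] at hen
  linear_combination h.e_neg + hen - entireExpIntegral (x t) * h.p_add_q

theorem x_lt_z_of_x_eq_y (h : VortexTriangle a b c p q M e x y z A) {t : ℝ} (hxy : x t = y t) :
    x t < z t := by
  refine strictMono_entireExpIntegral.lt_iff_lt.1 ?_
  have hen := h.energy t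
  rw [← hxy] at hen
  linear_combination h.e_neg + hen - entireExpIntegral (x t) * h.p_add_q

theorem hasEventualSign_x_sub_z (h : VortexTriangle a b c p q M e x y z A)
    (hA0 : ∀ᶠ t in atTop, A t ≠ 0) : HasEventualSign fun t => x t - z t := by
  refine HasEventualSign.of_hasDerivAt_mul h.continuous_A hA0
    (fun t => (h.hasDerivAt_x t).sub (h.hasDerivAt_z t)) ?_
  filter_upwards [hA0] with t hAt hxz
  have hxz : x t = z t := sub_eq_zero.1 hxz
  have hE : 0 < expQuotient (y t) - expQuotient (x t) :=
    sub_pos.2 (strictAntiOn_expQuotient (h.y_nonneg t) (h.x_nonneg t) (h.y_lt_x_of_x_eq_z hxz))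
  have hac : a + c = a * q := by linear_combination (-a) * h.p_add_q + h.a_mul_p
  have ha := h.a_pos
  have hq := h.q_pos
  calc 0 < A t ^ 2 / Real.pi * (a * q) * (expQuotient (y t) - expQuotient (x t)) := by positivity
    _ = _ := by rw [← hac, hxz]; ring

theorem hasEventualSign_y_sub_z (h : VortexTriangle a b c p q M e x y z A)
    (hA0 : ∀ᶠ t in atTop, A t ≠ 0) : HasEventualSign fun t => y t - z t :=
  h.swap.hasEventualSign_x_sub_z (hA0.mono fun _ => neg_ne_zero.2)

theorem hasEventualSign_x_sub_y (h : VortexTriangle a b c p q M e x y z A)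
    (hA0 : ∀ᶠ t in atTop, A t ≠ 0) : HasEventualSign fun t => x t - y t := by
  refine HasEventualSign.of_hasDerivAt_mul h.continuous_A hA0
    (fun t => (h.hasDerivAt_x t).sub (h.hasDerivAt_y t)) ?_
  filter_upwards [hA0] with t hAt hxy
  have hxy : x t = y t := sub_eq_zero.1 hxy
  have hE : 0 < expQuotient (x t) - expQuotient (z t) :=
    sub_pos.2 (strictAntiOn_expQuotient (h.x_nonneg t) (h.z_nonneg t) (h.x_lt_z_of_x_eq_y hxy))
  have ha := h.a_pos
  have hb := h.b_pos
  calc 0 < A t ^ 2 / Real.pi * (a + b) * (expQuotient (x t) - expQuotient (z t)) := by positivity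
    _ = _ := by rw [hxy]; ring

theorem tendsto_x_or_tendsto_x_atTop (h : VortexTriangle a b c p q M e x y z A)
    (hA0 : ∀ᶠ t in atTop, A t ≠ 0) :
    (∃ l, Tendsto x atTop (𝓝 l)) ∨ Tendsto x atTop atTop :=
  tendsto_or_tendsto_atTop h.hasDerivAt_x h.x_nonneg
    (((HasEventualSign.const _).mul (.of_continuous_of_ne_zero h.continuous_A hA0)).mul
      (.expQuotient_sub_expQuotient h.y_nonneg h.z_nonneg (h.hasEventualSign_y_sub_z hA0)))

theorem tendsto_y_or_tendsto_y_atTop (h : VortexTriangle a b c p q M e x y z A)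
    (hA0 : ∀ᶠ t in atTop, A t ≠ 0) :
    (∃ l, Tendsto y atTop (𝓝 l)) ∨ Tendsto y atTop atTop :=
  h.swap.tendsto_x_or_tendsto_x_atTop (hA0.mono fun _ => neg_ne_zero.2)

section Limit

variable {l₁ l₂ l₃ : ℝ}

theorem not_equilateral_of_tendsto (h : VortexTriangle a b c p q M e x y z A)
    (hx : Tendsto x atTop (𝓝 l₁)) (hy : Tendsto y atTop (𝓝 l₂)) (hz : Tendsto z atTop (𝓝 l₃)) :
    ¬(l₁ = l₂ ∧ l₂ = l₃) := by
  rintro ⟨rfl, rfl⟩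
  have hEin := continuous_entireExpIntegral.tendsto l₁
  have henergy := tendsto_nhds_unique
    ((((hEin.comp hx).const_mul p).add ((hEin.comp hy).const_mul q)).sub (hEin.comp hz))
    (tendsto_const_nhds.congr fun t => (h.energy t).symm)
  rw [← add_mul, h.p_add_q, one_mul, sub_self] at henergy
  exact h.e_neg.ne henergy.symm

theorem tendsto_A_zero_of_tendsto (h : VortexTriangle a b c p q M e x y z A)
    (hA0 : ∀ᶠ t in atTop, A t ≠ 0) (hx : Tendsto x atTop (𝓝 l₁))
    (hy : Tendsto y atTop (𝓝 l₂)) (hz : Tendsto z atTop (𝓝 l₃)) :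
    Tendsto A atTop (𝓝 0) := by
  have n₁ : 0 ≤ l₁ := ge_of_tendsto' hx h.x_nonneg
  have n₂ : 0 ≤ l₂ := ge_of_tendsto' hy h.y_nonneg
  have n₃ : 0 ≤ l₃ := ge_of_tendsto' hz h.z_nonneg
  have hE := continuous_expQuotient.tendsto
  have hA2 : Tendsto (fun t => A t ^ 2) atTop
      (𝓝 ((4 * l₁ * l₂ - (l₃ - l₁ - l₂) ^ 2) / 4)) :=
    ((((hx.const_mul 4).mul hy).sub (((hz.sub hx).sub hy).pow 2)).div_const 4).congr fun t => by
      linarith [h.heron t]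
  obtain ⟨k, hk, -⟩ := exists_tendsto_of_tendsto_sq h.continuous_A hA0 hA2
  have hx' := eq_zero_of_tendsto_of_tendsto_deriv h.hasDerivAt_x hx
    ((hk.const_mul (a / Real.pi)).mul (((hE l₂).comp hy).sub ((hE l₃).comp hz)))
  have hz' := eq_zero_of_tendsto_of_tendsto_deriv h.hasDerivAt_z hz
    ((hk.const_mul (c / Real.pi)).mul (((hE l₁).comp hx).sub ((hE l₂).comp hy)))
  rcases eq_or_ne k 0 with rfl | hk0
  · exact hk
  have ha := div_ne_zero h.a_pos.ne' Real.pi_ne_zero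
  have hc := div_ne_zero h.c_neg.ne Real.pi_ne_zero
  have h₂₃ := (mul_eq_zero.1 hx').resolve_left (mul_ne_zero ha hk0)
  have h₁₂ := (mul_eq_zero.1 hz').resolve_left (mul_ne_zero hc hk0)
  exact absurd ⟨strictAntiOn_expQuotient.injOn n₁ n₂ (sub_eq_zero.1 h₁₂),
    strictAntiOn_expQuotient.injOn n₂ n₃ (sub_eq_zero.1 h₂₃)⟩
    (h.not_equilateral_of_tendsto hx hy hz)

theorem isCollinearEquilibrium_of_tendsto (h : VortexTriangle a b c p q M e x y z A)
    (hA0 : ∀ᶠ t in atTop, A t ≠ 0) (hx : Tendsto x atTop (𝓝 l₁))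
    (hy : Tendsto y atTop (𝓝 l₂)) (hz : Tendsto z atTop (𝓝 l₃)) :
    IsCollinearEquilibrium a b c l₁ l₂ l₃ := by
  have hA := h.tendsto_A_zero_of_tendsto hA0 hx hy hz
  have hheron : 4 * l₁ * l₂ = (l₃ - l₁ - l₂) ^ 2 := by
    have hsides : Tendsto (fun t => 4 * A t ^ 2) atTop (𝓝 (4 * l₁ * l₂ - (l₃ - l₁ - l₂) ^ 2)) :=
      (((hx.const_mul 4).mul hy).sub (((hz.sub hx).sub hy).pow 2)).congr fun t =>
        (h.heron t).symm
    have hlim := tendsto_nhds_unique ((hA.pow 2).const_mul 4) hsides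
    linarith
  refine ⟨ge_of_tendsto' hx h.x_nonneg, ge_of_tendsto' hy h.y_nonneg, hheron, ?_, ?_⟩
  · have hrate : Tendsto (fun t => areaRate a b c (x t) (y t) (z t)) atTop
        (𝓝 (areaRate a b c l₁ l₂ l₃)) := by
      simpa only [Function.comp_def] using ((continuous_areaRate a b c).tendsto (l₁, l₂, l₃)).comp
        (hx.prodMk_nhds (hy.prodMk_nhds hz))
    exact eq_zero_of_tendsto_of_tendsto_deriv h.hasDerivAt_A hA hrate
  · by_contra! hzero
    obtain ⟨rfl, rfl⟩ := hzero
    have hl₃ : l₃ ^ 2 = 0 := by linarith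
    exact h.not_equilateral_of_tendsto hx hy hz ⟨rfl, (pow_eq_zero_iff two_ne_zero).1 hl₃ |>.symm⟩

end Limit

end VortexTriangle

/-! ### Expanding triangles -/

/-- The normalized logarithmic energy of a triangle with squared sides `1`, `k` and `p + q * k`, the
limit shape of an expanding vortex triangle. -/
def logRatio (p q k : ℝ) : ℝ := q * Real.log k - Real.log (p + q * k)

/-- Sixteen times the squared area, by Heron's formula, of a triangle with squared sides `1`, `k`
and `p + q * k`, where `p + q = 1`. -/
def limitHeron (p q k : ℝ) : ℝ := 4 * k - (q + p * k) ^ 2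

section LimitShape

variable {p q k : ℝ}

theorem continuousOn_logRatio (hp : 0 < p) (hq : 0 < q) : ContinuousOn (logRatio p q) (Ioi 0) := by
  unfold logRatio
  refine (continuousOn_const.mul (continuousOn_id.log fun k hk => ?_)).sub
    (ContinuousOn.log (by fun_prop) fun k hk => ?_)
  · exact (show 0 < k from hk).ne'
  · have : 0 < k := hk
    positivity

theorem hasDerivAt_logRatio (hp : 0 < p) (hq : 0 < q) (hpq : p + q = 1) (hk : 0 < k) :
    HasDerivAt (logRatio p q) (q * p * (1 - k) / (k * (p + q * k))) k := by
  have hlinear : HasDerivAt (fun k : ℝ => p + q * k) q k := by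
    simpa using ((hasDerivAt_id k).const_mul q).const_add p
  have hden : p + q * k ≠ 0 := by positivity
  convert! ((Real.hasDerivAt_log hk.ne').const_mul q).sub (hlinear.log hden) using 1
  field_simp
  linear_combination (-k) * hpq

theorem strictAntiOn_logRatio (hp : 0 < p) (hq : 0 < q) (hpq : p + q = 1) :
    StrictAntiOn (logRatio p q) (Ici 1) := by
  refine strictAntiOn_of_deriv_neg (convex_Ici 1)
    ((continuousOn_logRatio hp hq).mono (Ici_subset_Ioi.2 one_pos)) fun k hk => ?_
  rw [interior_Ici, mem_Ioi] at hk
  have hk0 : 0 < k := one_pos.trans hk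
  rw [(hasDerivAt_logRatio hp hq hpq hk0).deriv]
  exact div_neg_of_neg_of_pos (mul_neg_of_pos_of_neg (by positivity) (sub_neg.2 hk))
    (by positivity)

theorem logRatio_one (hpq : p + q = 1) : logRatio p q 1 = 0 := by
  simp [logRatio, hpq]

theorem logRatio_le (hp : 0 ≤ p) (hq : 0 < q) (hpq : p + q = 1) (hk : 0 < k) :
    logRatio p q k ≤ -p * Real.log k - Real.log q := by
  have hlog : Real.log (q * k) ≤ Real.log (p + q * k) :=
    Real.log_le_log (by positivity) (le_add_of_nonneg_left hp)
  rw [Real.log_mul hq.ne' hk.ne'] at hlog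
  unfold logRatio
  linear_combination hlog + Real.log k * hpq

theorem exists_logRatio_eq {v : ℝ} (hp : 0 < p) (hq : 0 < q) (hpq : p + q = 1) (hv : v < 0) :
    ∃ k, 1 < k ∧ logRatio p q k = v := by
  have hupper : Tendsto (fun k => -p * Real.log k - Real.log q) atTop atBot :=
    tendsto_atBot_add_const_right _ _
      (Real.tendsto_log_atTop.const_mul_atTop_of_neg (neg_neg_of_pos hp))
  obtain ⟨K, hK, hKv⟩ := ((eventually_ge_atTop (1 : ℝ)).and (hupper.eventually_le_atBot v)).exists
  obtain ⟨k, hk, hkv⟩ := intermediate_value_Icc' hK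
    ((continuousOn_logRatio hp hq).mono fun u hu => one_pos.trans_le hu.1)
    ⟨(logRatio_le hp.le hq hpq (one_pos.trans_le hK)).trans hKv, (logRatio_one hpq).symm ▸ hv.le⟩
  refine ⟨k, lt_of_le_of_ne hk.1 ?_, hkv⟩
  rintro rfl
  exact hv.ne' (logRatio_one hpq ▸ hkv)

theorem tendsto_of_tendsto_logRatio (hp : 0 < p) (hq : 0 < q) (hpq : p + q = 1)
    (hk : 1 < k) {κ : ℝ → ℝ} (hκ : ∀ᶠ t in atTop, 1 ≤ κ t)
    (hlim : Tendsto (fun t => logRatio p q (κ t)) atTop (𝓝 (logRatio p q k))) :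
    Tendsto κ atTop (𝓝 k) := by
  have hanti := strictAntiOn_logRatio hp hq hpq
  refine tendsto_order.2 ⟨fun u hu => ?_, fun u hu => ?_⟩
  · have hu1 : (1 : ℝ) ≤ max u 1 := le_max_right u 1
    filter_upwards [hκ, hlim.eventually_lt_const (hanti hu1 hk.le (max_lt hu hk))] with t ht ht'
    exact (le_max_left u 1).trans_lt ((hanti.lt_iff_gt ht hu1).1 ht')
  · have hu1 : 1 ≤ u := hk.le.trans hu.le
    filter_upwards [hκ, hlim.eventually_const_lt (hanti hk.le hu1 hu)] with t ht ht'
    exact (hanti.lt_iff_gt hu1 ht).1 ht'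

theorem sub_one_mul_limitHeron (hpq : p + q = 1) (κ : ℝ) :
    (k - 1) * limitHeron p q κ = 3 * (k - κ) + (κ - 1) * limitHeron p q k +
      p ^ 2 * (κ - 1) * (k - κ) * (k - 1) := by
  rw [limitHeron, limitHeron, eq_sub_of_add_eq' hpq]
  ring

theorem limitHeron_nonneg_of_le {κ : ℝ} (hpq : p + q = 1) (hκ : 1 ≤ κ) (hκk : κ ≤ k) (hk : 1 < k)
    (hQ : 0 ≤ limitHeron p q k) : 0 ≤ limitHeron p q κ := by
  refine nonneg_of_mul_nonneg_right ?_ (sub_pos.2 hk)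
  have := sub_nonneg.2 hκ
  have := sub_nonneg.2 hκk
  have := sub_nonneg.2 hk.le
  rw [sub_one_mul_limitHeron hpq]
  positivity

theorem limitHeron_neg_of_lt {κ : ℝ} (hpq : p + q = 1) (hk : 1 < k) (hkκ : k < κ)
    (hQ : limitHeron p q k ≤ 0) : limitHeron p q κ < 0 := by
  refine neg_of_mul_neg_right (a := k - 1) ?_ (sub_nonneg.2 hk.le)
  have hκ : 0 ≤ κ - 1 := sub_nonneg.2 (hk.trans hkκ).le
  have hchord := mul_nonpos_of_nonneg_of_nonpos hκ hQ
  have hbulge : p ^ 2 * (κ - 1) * (k - κ) * (k - 1) ≤ 0 :=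
    mul_nonpos_of_nonpos_of_nonneg
      (mul_nonpos_of_nonneg_of_nonpos (by positivity) (sub_nonpos.2 hkκ.le)) (sub_nonneg.2 hk.le)
  rw [sub_one_mul_limitHeron hpq]
  linarith

end LimitShape

namespace VortexTriangle

variable {a b c p q M e k : ℝ} {x y z A : ℝ → ℝ}

theorem z_eq (h : VortexTriangle a b c p q M e x y z A) (t : ℝ) : z t = p * x t + q * y t - M := by
  linarith [h.moment t]

theorem heron_eq_limitHeron (h : VortexTriangle a b c p q M e x y z A) {t : ℝ} (hx : 0 < x t) :
    4 * A t ^ 2 =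
      x t ^ 2 * limitHeron p q (y t / x t) - M * (2 * (q * x t + p * y t) + M) := by
  have hz : z t - x t - y t = -(q * x t + p * y t + M) := by
    rw [h.z_eq]
    linear_combination (x t + y t) * h.p_add_q
  rw [h.heron, hz, limitHeron]
  field_simp
  ring

theorem logRatio_eq (h : VortexTriangle a b c p q M e x y z A) {t : ℝ} (hx : 0 < x t)
    (hy : 0 < y t) (hz : 0 < z t) :
    logRatio p q (y t / x t) =
      e - (p * expIntegral (x t) + q * expIntegral (y t) - expIntegral (z t)) -
        Real.log ((z t + M) / z t) := by
  have hp := h.p_pos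
  have hq := h.q_pos
  have hzM : z t + M = x t * (p + q * (y t / x t)) := by
    rw [h.z_eq]
    field_simp
    ring
  have hden : p + q * (y t / x t) ≠ 0 := by positivity
  rw [hzM, Real.log_div (by positivity) hz.ne', Real.log_mul hx.ne' hden, logRatio,
    Real.log_div hy.ne' hx.ne']
  linear_combination h.energy t + p * entireExpIntegral_sub_entireExpIntegral hx hz +
    q * entireExpIntegral_sub_entireExpIntegral hy hz +
    (Real.log (z t) + expIntegral (z t) - entireExpIntegral (z t) - Real.log (x t)) * h.p_add_q

theorem tendsto_z_atTop (h : VortexTriangle a b c p q M e x y z A) (hy : Tendsto y atTop atTop) :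
    Tendsto z atTop atTop := by
  refine tendsto_atTop_mono (fun t => ?_)
    (tendsto_atTop_add_const_right atTop (-M) (hy.const_mul_atTop h.q_pos))
  linarith [h.z_eq t, mul_nonneg h.p_pos.le (h.x_nonneg t)]

theorem tendsto_x_atTop (h : VortexTriangle a b c p q M e x y z A) (hy : Tendsto y atTop atTop) :
    Tendsto x atTop atTop := by
  have hq2 : 0 < q / 2 := half_pos h.q_pos
  have hgap : Tendsto
      (fun t => entireExpIntegral (q / 2 * y t) - entireExpIntegral (y t)) atTop
      (𝓝 (Real.log (q / 2))) := by
    have htail := ((tendsto_expIntegral.comp (hy.const_mul_atTop hq2)).sub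
      (tendsto_expIntegral.comp hy)).const_add (Real.log (q / 2))
    rw [sub_zero, add_zero] at htail
    refine htail.congr' ?_
    filter_upwards [hy.eventually_gt_atTop 0] with t hyt
    rw [entireExpIntegral_sub_entireExpIntegral hyt (by positivity),
      Real.log_mul hq2.ne' hyt.ne', Function.comp_apply, Function.comp_apply]
    ring
  have hlower : Tendsto (fun t => p * entireExpIntegral (y t) + (e +
      (entireExpIntegral (q / 2 * y t) - entireExpIntegral (y t)))) atTop atTop :=
    ((tendsto_entireExpIntegral_atTop.comp hy).const_mul_atTop h.p_pos).atTop_add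
      (hgap.const_add e)
  have hEin : Tendsto (fun t => p * entireExpIntegral (x t)) atTop atTop := by
    refine tendsto_atTop_mono' atTop ?_ hlower
    filter_upwards [hy.eventually_ge_atTop (2 * M / q)] with t hyM
    have hz : q / 2 * y t ≤ z t := by
      rw [div_le_iff₀ h.q_pos] at hyM
      linarith [h.z_eq t, mul_nonneg h.p_pos.le (h.x_nonneg t)]
    linear_combination strictMono_entireExpIntegral.monotone hz - h.energy t +
      entireExpIntegral (y t) * h.p_add_q
  refine tendsto_atTop.2 fun R => ?_
  filter_upwards [hEin.eventually_ge_atTop (p * entireExpIntegral R)] with t ht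
  exact strictMono_entireExpIntegral.le_iff_le.1 (le_of_mul_le_mul_left ht h.p_pos)

theorem tendsto_ratio (h : VortexTriangle a b c p q M e x y z A)
    (hxy : ∀ᶠ t in atTop, x t ≤ y t) (hy : Tendsto y atTop atTop) (hk : 1 < k)
    (hke : logRatio p q k = e) : Tendsto (fun t => y t / x t) atTop (𝓝 k) := by
  have hx := h.tendsto_x_atTop hy
  have hz := h.tendsto_z_atTop hy
  have hmoment : Tendsto (fun t => (z t + M) / z t) atTop (𝓝 1) := by
    have hone : Tendsto (fun t => 1 + M / z t) atTop (𝓝 (1 + 0)) :=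
      tendsto_const_nhds.add (hz.const_div_atTop M)
    rw [add_zero] at hone
    refine hone.congr' ?_
    filter_upwards [hz.eventually_ne_atTop 0] with t ht
    rw [add_div, div_self ht]
  refine tendsto_of_tendsto_logRatio h.p_pos h.q_pos h.p_add_q hk ?_ ?_
  · filter_upwards [hxy, hx.eventually_gt_atTop 0] with t ht hx0 using (one_le_div hx0).2 ht
  · have hlim := (((((tendsto_expIntegral.comp hx).const_mul p).add
      ((tendsto_expIntegral.comp hy).const_mul q)).sub (tendsto_expIntegral.comp hz)).const_sub
        e).sub (hmoment.log one_ne_zero)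
    simp only [mul_zero, add_zero, sub_zero, Real.log_one] at hlim
    rw [hke]
    refine hlim.congr' ?_
    filter_upwards [hx.eventually_gt_atTop 0, hy.eventually_gt_atTop 0, hz.eventually_gt_atTop 0]
      with t hx0 hy0 hz0 using (h.logRatio_eq hx0 hy0 hz0).symm

theorem tendsto_z_div_x (h : VortexTriangle a b c p q M e x y z A)
    (hxy : ∀ᶠ t in atTop, x t ≤ y t) (hy : Tendsto y atTop atTop) (hk : 1 < k)
    (hke : logRatio p q k = e) : Tendsto (fun t => z t / x t) atTop (𝓝 (p + q * k)) := by
  have hx := h.tendsto_x_atTop hy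
  rw [← sub_zero (p + q * k)]
  refine ((((h.tendsto_ratio hxy hy hk hke).const_mul q).const_add p).sub
    (hx.const_div_atTop M)).congr' ?_
  filter_upwards [hx.eventually_gt_atTop 0] with t hx0
  rw [h.z_eq]
  field_simp

theorem tendsto_area_sq_div_sq (h : VortexTriangle a b c p q M e x y z A)
    (hxy : ∀ᶠ t in atTop, x t ≤ y t) (hy : Tendsto y atTop atTop) (hk : 1 < k)
    (hke : logRatio p q k = e) :
    Tendsto (fun t => 4 * A t ^ 2 / x t ^ 2) atTop (𝓝 (limitHeron p q k)) := by
  have hx := h.tendsto_x_atTop hy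
  have hratio := h.tendsto_ratio hxy hy hk hke
  have hMx : Tendsto (fun t => M / x t) atTop (𝓝 0) := hx.const_div_atTop M
  have hlim := ((hratio.const_mul 4).sub (((hratio.const_mul p).const_add q).pow 2)).sub
    (hMx.mul ((((hratio.const_mul p).const_add q).const_mul 2).add hMx))
  rw [zero_mul, sub_zero] at hlim
  refine hlim.congr' ?_
  filter_upwards [hx.eventually_gt_atTop 0] with t hx0
  rw [h.heron_eq_limitHeron hx0, limitHeron]
  field_simp

theorem eventually_ratio_le_of_moment_neg (h : VortexTriangle a b c p q M e x y z A)
    (hxy : ∀ᶠ t in atTop, x t ≤ y t) (hy : Tendsto y atTop atTop) (hk : 1 < k)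
    (hke : logRatio p q k = e) (hM : M < 0) : ∀ᶠ t in atTop, y t / x t ≤ k := by
  have hx := h.tendsto_x_atTop hy
  have hz := h.tendsto_z_atTop hy
  have hexp : Tendsto (fun t => Real.exp (-x t) * (z t / x t)) atTop (𝓝 (0 * (p + q * k))) :=
    (Real.tendsto_exp_neg_atTop_nhds_zero.comp hx).mul (h.tendsto_z_div_x hxy hy hk hke)
  rw [zero_mul] at hexp
  filter_upwards [hxy, hx.eventually_gt_atTop 0, hy.eventually_gt_atTop 0, hz.eventually_gt_atTop 0,
    hz.eventually_gt_atTop (-M), hexp.eventually_lt_const (neg_pos.2 hM)]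
    with t hle hx0 hy0 hz0 hzM hexp
  have htail : p * expIntegral (x t) + q * expIntegral (y t) ≤ -M / z t :=
    calc p * expIntegral (x t) + q * expIntegral (y t)
        ≤ p * expIntegral (x t) + q * expIntegral (x t) := by
          have := expIntegral_le_expIntegral hx0 hle
          have := h.q_pos
          gcongr
      _ = expIntegral (x t) := by rw [← add_mul, h.p_add_q, one_mul]
      _ ≤ Real.exp (-x t) / x t := expIntegral_le hx0
      _ = Real.exp (-x t) * (z t / x t) / z t := by field_simp
      _ ≤ -M / z t := by gcongr
  have hlog : Real.log ((z t + M) / z t) ≤ M / z t := by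
    refine (Real.log_le_sub_one_of_pos (div_pos (by linarith) hz0)).trans_eq ?_
    rw [add_div, div_self hz0.ne', add_sub_cancel_left]
  refine ((strictAntiOn_logRatio h.p_pos h.q_pos h.p_add_q).le_iff_ge hk.le
    ((one_le_div hx0).2 hle)).1 ?_
  rw [hke, h.logRatio_eq hx0 hy0 hz0]
  rw [neg_div] at htail
  linarith [expIntegral_pos hz0]

theorem eventually_lt_ratio_of_moment_nonneg (h : VortexTriangle a b c p q M e x y z A)
    (hxy : ∀ᶠ t in atTop, x t ≤ y t) (hy : Tendsto y atTop atTop) (hk : 1 < k)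
    (hke : logRatio p q k = e) (hM : 0 ≤ M) : ∀ᶠ t in atTop, k < y t / x t := by
  have hx := h.tendsto_x_atTop hy
  have hz := h.tendsto_z_atTop hy
  have hdiff : Tendsto (fun t => z t - x t) atTop atTop := by
    have hlim := tendsto_atTop_add_const_right atTop (-M)
      ((((h.tendsto_ratio hxy hy hk hke).sub_const 1).pos_mul_atTop
        (sub_pos.2 hk) hx).const_mul_atTop h.q_pos)
    refine hlim.congr' ?_
    filter_upwards [hx.eventually_gt_atTop 0] with t hx0
    rw [h.z_eq]
    field_simp
    linear_combination (-x t) * h.p_add_q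
  filter_upwards [hxy, hx.eventually_gt_atTop 0, hy.eventually_gt_atTop 0,
    hz.eventually_gt_atTop 0, hdiff.eventually_ge_atTop 0,
    (Real.tendsto_exp_neg_atTop_nhds_zero.comp hdiff).eventually_lt_const h.p_pos]
    with t hle hx0 hy0 hz0 hzx (hexp : Real.exp (-(z t - x t)) < p)
  have htail : expIntegral (z t) < p * expIntegral (x t) + q * expIntegral (y t) :=
    calc expIntegral (z t) = expIntegral (x t + (z t - x t)) := by rw [add_sub_cancel]
      _ ≤ Real.exp (-(z t - x t)) * expIntegral (x t) := expIntegral_add_le hx0 hzx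
      _ < p * expIntegral (x t) := mul_lt_mul_of_pos_right hexp (expIntegral_pos hx0)
      _ < p * expIntegral (x t) + q * expIntegral (y t) :=
        lt_add_of_pos_right _ (mul_pos h.q_pos (expIntegral_pos hy0))
  have hlog : 0 ≤ Real.log ((z t + M) / z t) :=
    Real.log_nonneg ((one_le_div hz0).2 (le_add_of_nonneg_right hM))
  refine ((strictAntiOn_logRatio h.p_pos h.q_pos h.p_add_q).lt_iff_gt
    ((one_le_div hx0).2 hle) hk.le).1 ?_
  rw [hke, h.logRatio_eq hx0 hy0 hz0]
  linarith

theorem moment_neg_of_limitHeron_nonpos (h : VortexTriangle a b c p q M e x y z A)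
    (hxy : ∀ᶠ t in atTop, x t ≤ y t) (hy : Tendsto y atTop atTop) (hk : 1 < k)
    (hke : logRatio p q k = e) (hQ : limitHeron p q k ≤ 0) : M < 0 := by
  by_contra! hM
  obtain ⟨t, hkκ, hx0⟩ := ((h.eventually_lt_ratio_of_moment_nonneg hxy hy hk hke hM).and
    ((h.tendsto_x_atTop hy).eventually_gt_atTop 0)).exists
  have hneg : x t ^ 2 * limitHeron p q (y t / x t) < 0 :=
    mul_neg_of_pos_of_neg (by positivity) (limitHeron_neg_of_lt h.p_add_q hk hkκ hQ)
  have hmoment : 0 ≤ M * (2 * (q * x t + p * y t) + M) := by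
    have := h.p_pos
    have := h.q_pos
    have := h.y_nonneg t
    positivity
  linarith [h.heron_eq_limitHeron hx0, sq_nonneg (A t)]

theorem tendsto_area_sq_of_moment_neg (h : VortexTriangle a b c p q M e x y z A)
    (hxy : ∀ᶠ t in atTop, x t ≤ y t) (hy : Tendsto y atTop atTop) (hk : 1 < k)
    (hke : logRatio p q k = e) (hQ : 0 ≤ limitHeron p q k) (hM : M < 0) :
    Tendsto (fun t => 4 * A t ^ 2) atTop atTop := by
  have hx := h.tendsto_x_atTop hy
  have hlin : Tendsto (fun t => -M * (2 * (q * x t + p * y t) + M)) atTop atTop :=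
    (tendsto_atTop_add_const_right atTop M (((hx.const_mul_atTop h.q_pos).atTop_add_atTop
      (hy.const_mul_atTop h.p_pos)).const_mul_atTop two_pos)).const_mul_atTop (neg_pos.2 hM)
  refine tendsto_atTop_mono' atTop ?_ hlin
  filter_upwards [hxy, hx.eventually_gt_atTop 0,
    h.eventually_ratio_le_of_moment_neg hxy hy hk hke hM] with t hle hx0 hκk
  have hshape := mul_nonneg (sq_nonneg (x t))
    (limitHeron_nonneg_of_le h.p_add_q ((one_le_div hx0).2 hle) hκk hk hQ)
  linarith [h.heron_eq_limitHeron hx0]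

theorem tendsto_area_sq_atTop (h : VortexTriangle a b c p q M e x y z A)
    (hxy : ∀ᶠ t in atTop, x t ≤ y t) (hy : Tendsto y atTop atTop) :
    Tendsto (fun t => 4 * A t ^ 2) atTop atTop := by
  obtain ⟨k, hk, hke⟩ := exists_logRatio_eq h.p_pos h.q_pos h.p_add_q h.e_neg
  have hlim := h.tendsto_area_sq_div_sq hxy hy hk hke
  have hQ : 0 ≤ limitHeron p q k := ge_of_tendsto' hlim fun t => by positivity
  rcases hQ.eq_or_lt with hQ0 | hQ0
  · exact h.tendsto_area_sq_of_moment_neg hxy hy hk hke hQ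
      (h.moment_neg_of_limitHeron_nonpos hxy hy hk hke hQ0.ge)
  · have hx := h.tendsto_x_atTop hy
    refine (hlim.pos_mul_atTop hQ0 ((tendsto_pow_atTop two_ne_zero).comp hx)).congr' ?_
    filter_upwards [hx.eventually_ne_atTop 0] with t hx0
    exact div_mul_cancel₀ _ (pow_ne_zero 2 hx0)

end VortexTriangle

/-! ### Integrability of the enstrophy density -/

theorem exp_neg_half_le_div {u : ℝ} (hu : 0 < u) :
    Real.exp (-u / 2) ≤ 4 / u * Real.exp (-u / 4) := by
  have hquarter : Real.exp (-u / 4) ≤ 4 / u := by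
    have hexp : u / 4 ≤ Real.exp (u / 4) := by linarith [Real.add_one_le_exp (u / 4)]
    rw [neg_div, Real.exp_neg, ← inv_div u]
    exact inv_anti₀ (by positivity) hexp
  calc Real.exp (-u / 2) = Real.exp (-u / 4) * Real.exp (-u / 4) := by
        rw [← Real.exp_add]
        ring_nf
    _ ≤ 4 / u * Real.exp (-u / 4) := by gcongr

theorem integrableOn_exp_of_deriv_ge {f f' : ℝ → ℝ} {k : ℝ} (hk : 0 < k)
    (hf : ∀ t, HasDerivAt f (f' t) t) (hlim : Tendsto f atTop atTop)
    (hf' : ∀ᶠ t in atTop, k / f t ≤ f' t) :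
    ∃ T, IntegrableOn (fun t => Real.exp (-f t / 2)) (Ioi T) := by
  obtain ⟨T, hT⟩ := eventually_atTop.1 (hf'.and (hlim.eventually_gt_atTop 0))
  have hcont : Continuous f := continuous_iff_continuousAt.2 fun t => (hf t).continuousAt
  have hderiv (t : ℝ) :
      HasDerivAt (fun t => -4 * Real.exp (-f t / 4)) (Real.exp (-f t / 4) * f' t) t := by
    convert! (((hf t).neg.div_const 4).exp).const_mul (-4) using 1
    simp only [Pi.neg_apply]
    ring
  have hdecay : Tendsto (fun t => -4 * Real.exp (-f t / 4)) atTop (𝓝 (-4 * 0)) := by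
    refine (Real.tendsto_exp_atBot.comp ?_).const_mul (-4)
    exact (tendsto_neg_atTop_atBot.comp hlim).atBot_div_const four_pos
  have hint : IntegrableOn (fun t => Real.exp (-f t / 4) * f' t) (Ioi T) := by
    refine integrableOn_Ioi_deriv_of_nonneg' (fun t _ => hderiv t) (fun t ht => ?_) hdecay
    obtain ⟨hrate, hpos⟩ := hT t (le_of_lt ht)
    exact mul_nonneg (Real.exp_pos _).le ((div_pos hk hpos).le.trans hrate)
  refine ⟨T, (hint.const_mul (4 / k)).mono' (by fun_prop)
    (ae_restrict_of_forall_mem measurableSet_Ioi fun t ht => ?_)⟩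
  obtain ⟨hrate, hpos⟩ := hT t (le_of_lt ht)
  rw [Real.norm_of_nonneg (Real.exp_pos _).le]
  calc Real.exp (-f t / 2) ≤ 4 / f t * Real.exp (-f t / 4) := exp_neg_half_le_div hpos
    _ = 4 / k * (Real.exp (-f t / 4) * (k / f t)) := by field_simp
    _ ≤ 4 / k * (Real.exp (-f t / 4) * f' t) := by gcongr

/-- The enstrophy of a triangle of vortices with squared sides `x`, `y`, `z`, divided by
`a * b / (2 * π)`, for circulations `a`, `b`, `c` and weights `p`, `q` as in `VortexTriangle`. -/
def enstrophyDensity (p q x y z : ℝ) : ℝ :=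
  p * Real.exp (-x / 2) + q * Real.exp (-y / 2) - Real.exp (-z / 2)

theorem enstrophyDensity_swap (p q x y z : ℝ) :
    enstrophyDensity q p y x z = enstrophyDensity p q x y z := by
  rw [enstrophyDensity, add_comm, enstrophyDensity]

theorem enstrophyDensity_le {p q x y : ℝ} (hq : 0 ≤ q) (hpq : p + q = 1) (hxy : x ≤ y) (z : ℝ) :
    enstrophyDensity p q x y z ≤ Real.exp (-x / 2) := by
  have hexp : q * Real.exp (-y / 2) ≤ q * Real.exp (-x / 2) := by gcongr
  unfold enstrophyDensity
  linear_combination hexp + (Real.exp_pos (-z / 2)).le + Real.exp (-x / 2) * hpq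

/-- Convergence of the squared distances along `l` to those of a collinear relative equilibrium. -/
def TendstoCollinearEquilibrium (a b c : ℝ) (x y z : ℝ → ℝ) (l : Filter ℝ) : Prop :=
  ∃ l₁ l₂ l₃, Tendsto x l (𝓝 l₁) ∧ Tendsto y l (𝓝 l₂) ∧ Tendsto z l (𝓝 l₃) ∧
    IsCollinearEquilibrium a b c l₁ l₂ l₃

theorem integrableAtFilter_atBot_of_comp_neg {f : ℝ → ℝ}
    (h : IntegrableAtFilter (fun t => f (-t)) atTop) : IntegrableAtFilter f atBot := by
  obtain ⟨s, hs, hint⟩ := h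
  refine ⟨Neg.neg ⁻¹' s, tendsto_neg_atBot_atTop hs, ?_⟩
  rw [← (Measure.measurePreserving_neg volume).integrableOn_comp_preimage
    (MeasurableEquiv.neg ℝ).measurableEmbedding]
  simpa only [Function.comp_def, preimage_preimage, neg_neg, preimage_id'] using hint

namespace VortexTriangle

variable {a b c p q M e : ℝ} {x y z A : ℝ → ℝ}

theorem enstrophyDensity_pos (h : VortexTriangle a b c p q M e x y z A) (t : ℝ) :
    0 < enstrophyDensity p q (x t) (y t) (z t) :=
  exp_neg_half_average_pos h.p_pos h.q_pos h.p_add_q (h.x_nonneg t) (h.y_nonneg t)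
    (sub_neg.1 ((h.energy t).trans_lt h.e_neg))

theorem continuous_enstrophyDensity (h : VortexTriangle a b c p q M e x y z A) :
    Continuous fun t => enstrophyDensity p q (x t) (y t) (z t) := by
  have := h.continuous_x
  have := h.continuous_y
  have := h.continuous_z
  unfold enstrophyDensity
  fun_prop

theorem eventually_div_le_expQuotient_sub (h : VortexTriangle a b c p q M e x y z A)
    (hxy : ∀ᶠ t in atTop, x t ≤ y t) (hy : Tendsto y atTop atTop) :
    ∃ δ, 0 < δ ∧ ∀ᶠ t in atTop, δ / x t ≤ expQuotient (z t) - expQuotient (y t) := by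
  obtain ⟨k, hk, hke⟩ := exists_logRatio_eq h.p_pos h.q_pos h.p_add_q h.e_neg
  have hk0 : 0 < k := one_pos.trans hk
  have hx := h.tendsto_x_atTop hy
  have hz := h.tendsto_z_atTop hy
  have hzk : 0 < p + q * k := add_pos h.p_pos (mul_pos h.q_pos hk0)
  have hlt : p + q * k < k := by
    linear_combination mul_lt_mul_of_pos_left hk h.p_pos + k * h.p_add_q
  have hlim : Tendsto (fun t => (z t / x t)⁻¹ * (1 - Real.exp (-z t)) - (y t / x t)⁻¹) atTop
      (𝓝 ((p + q * k)⁻¹ * (1 - 0) - k⁻¹)) :=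
    (((h.tendsto_z_div_x hxy hy hk hke).inv₀ hzk.ne').mul
      ((Real.tendsto_exp_neg_atTop_nhds_zero.comp hz).const_sub 1)).sub
      ((h.tendsto_ratio hxy hy hk hke).inv₀ hk0.ne')
  rw [sub_zero, mul_one] at hlim
  have hgap : 0 < (p + q * k)⁻¹ - k⁻¹ := sub_pos.2 (inv_strictAnti₀ hzk hlt)
  refine ⟨_, half_pos hgap, ?_⟩
  filter_upwards [hlim.eventually_const_lt (half_lt_self hgap), hx.eventually_gt_atTop 0,
    hy.eventually_gt_atTop 0, hz.eventually_gt_atTop 0] with t ht hx0 hy0 hz0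
  have hexp : 0 < Real.exp (-y t) * (x t / y t) := by positivity
  rw [div_le_iff₀ hx0]
  calc _ ≤ (z t / x t)⁻¹ * (1 - Real.exp (-z t)) - (y t / x t)⁻¹ +
        Real.exp (-y t) * (x t / y t) := by linarith
    _ = (expQuotient (z t) - expQuotient (y t)) * x t := by
      rw [expQuotient_of_ne hy0.ne', expQuotient_of_ne hz0.ne']
      field_simp
      ring

theorem eventually_div_le_rate (h : VortexTriangle a b c p q M e x y z A)
    (hxy : ∀ᶠ t in atTop, x t ≤ y t) (hy : Tendsto y atTop atTop) :
    ∃ K, 0 < K ∧ ∀ᶠ t in atTop,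
      K / x t ≤ a / Real.pi * |A t| * (expQuotient (z t) - expQuotient (y t)) := by
  obtain ⟨δ, hδ, hgap⟩ := h.eventually_div_le_expQuotient_sub hxy hy
  have ha := h.a_pos
  have := Real.pi_pos
  refine ⟨a / Real.pi * (1 / 2) * δ, by positivity, ?_⟩
  filter_upwards [hgap, (h.tendsto_area_sq_atTop hxy hy).eventually_ge_atTop 1,
    (h.tendsto_x_atTop hy).eventually_gt_atTop 0] with t hgap harea hx0
  have hA : 1 / 2 ≤ |A t| := by
    refine le_of_sq_le_sq ?_ (abs_nonneg _)
    rw [sq_abs]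
    linarith
  rw [mul_div_assoc]
  gcongr

theorem eventually_area_neg (h : VortexTriangle a b c p q M e x y z A)
    (hA0 : ∀ᶠ t in atTop, A t ≠ 0) (hxy : ∀ᶠ t in atTop, x t ≤ y t)
    (hy : Tendsto y atTop atTop) : ∀ᶠ t in atTop, A t < 0 := by
  refine (eventually_pos_or_eventually_neg h.continuous_A hA0).resolve_left fun hA => ?_
  obtain ⟨K, hK, hrate⟩ := h.eventually_div_le_rate hxy hy
  have hx := h.tendsto_x_atTop hy
  obtain ⟨S, hS⟩ := eventually_atTop.1 (hrate.and (hA.and (hx.eventually_gt_atTop 0)))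
  have hanti : AntitoneOn x (Ici S) := by
    refine antitoneOn_of_deriv_nonpos (convex_Ici S) h.continuous_x.continuousOn
      (fun t _ => (h.hasDerivAt_x t).differentiableAt.differentiableWithinAt) fun t ht => ?_
    obtain ⟨hrate, hA, hx0⟩ := hS t (interior_subset ht)
    rw [abs_of_pos hA] at hrate
    rw [(h.hasDerivAt_x t).deriv]
    linarith [div_pos hK hx0]
  obtain ⟨t, hgt, ht⟩ := ((hx.eventually_gt_atTop (x S)).and (eventually_ge_atTop S)).exists
  exact (hanti self_mem_Ici ht ht).not_gt hgt

theorem integrableOn_exp_x (h : VortexTriangle a b c p q M e x y z A)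
    (hA0 : ∀ᶠ t in atTop, A t ≠ 0) (hxy : ∀ᶠ t in atTop, x t ≤ y t)
    (hy : Tendsto y atTop atTop) : ∃ T, IntegrableOn (fun t => Real.exp (-x t / 2)) (Ioi T) := by
  obtain ⟨K, hK, hrate⟩ := h.eventually_div_le_rate hxy hy
  refine integrableOn_exp_of_deriv_ge hK h.hasDerivAt_x (h.tendsto_x_atTop hy) ?_
  filter_upwards [hrate, h.eventually_area_neg hA0 hxy hy] with t ht hA
  rw [abs_of_neg hA] at ht
  linarith

theorem integrableAtFilter_enstrophyDensity_of_le (h : VortexTriangle a b c p q M e x y z A)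
    (hA0 : ∀ᶠ t in atTop, A t ≠ 0) (hxy : ∀ᶠ t in atTop, x t ≤ y t)
    (hy : Tendsto y atTop atTop) :
    IntegrableAtFilter (fun t => enstrophyDensity p q (x t) (y t) (z t)) atTop := by
  obtain ⟨T, hT⟩ := h.integrableOn_exp_x hA0 hxy hy
  obtain ⟨S, hS⟩ := eventually_atTop.1 hxy
  refine ⟨Ioi (max S T), Ioi_mem_atTop _, (hT.mono_set (Ioi_subset_Ioi (le_max_right _ _))).mono'
    h.continuous_enstrophyDensity.aestronglyMeasurable
    (ae_restrict_of_forall_mem measurableSet_Ioi fun t ht => ?_)⟩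
  rw [Real.norm_of_nonneg (h.enstrophyDensity_pos t).le]
  exact enstrophyDensity_le h.q_pos.le h.p_add_q (hS t ((le_max_left _ _).trans (le_of_lt ht))) _

theorem exists_tendsto_x_of_le (h : VortexTriangle a b c p q M e x y z A)
    (hA0 : ∀ᶠ t in atTop, A t ≠ 0) (hxy : ∀ᶠ t in atTop, x t ≤ y t) {l : ℝ}
    (hy : Tendsto y atTop (𝓝 l)) : ∃ l', Tendsto x atTop (𝓝 l') :=
  (h.tendsto_x_or_tendsto_x_atTop hA0).resolve_right fun hx =>
    not_tendsto_atTop_of_tendsto_nhds hy (tendsto_atTop_mono' atTop hxy hx)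

theorem tendstoCollinearEquilibrium_of_tendsto (h : VortexTriangle a b c p q M e x y z A)
    (hA0 : ∀ᶠ t in atTop, A t ≠ 0) {l₁ l₂ : ℝ} (hx : Tendsto x atTop (𝓝 l₁))
    (hy : Tendsto y atTop (𝓝 l₂)) : TendstoCollinearEquilibrium a b c x y z atTop := by
  have hz : Tendsto z atTop (𝓝 (p * l₁ + q * l₂ - M)) :=
    (((hx.const_mul p).add (hy.const_mul q)).sub_const M).congr fun t => (h.z_eq t).symm
  exact ⟨l₁, l₂, _, hx, hy, hz, h.isCollinearEquilibrium_of_tendsto hA0 hx hy hz⟩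

theorem integrableAtFilter_enstrophyDensity_atTop (h : VortexTriangle a b c p q M e x y z A)
    (hA0 : ∀ᶠ t in atTop, A t ≠ 0) (hne : ¬ TendstoCollinearEquilibrium a b c x y z atTop) :
    IntegrableAtFilter (fun t => enstrophyDensity p q (x t) (y t) (z t)) atTop := by
  rcases h.hasEventualSign_x_sub_y hA0 with hyx | hxy
  · have hyx : ∀ᶠ t in atTop, y t ≤ x t := hyx.mono fun _ => sub_nonneg.1
    have hA0' : ∀ᶠ t in atTop, -A t ≠ 0 := hA0.mono fun _ => neg_ne_zero.2
    rcases h.tendsto_x_or_tendsto_x_atTop hA0 with ⟨l₁, hx⟩ | hx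
    · obtain ⟨l₂, hy⟩ := h.swap.exists_tendsto_x_of_le hA0' hyx hx
      exact absurd (h.tendstoCollinearEquilibrium_of_tendsto hA0 hx hy) hne
    · simpa only [enstrophyDensity_swap] using
        h.swap.integrableAtFilter_enstrophyDensity_of_le hA0' hyx hx
  · have hxy : ∀ᶠ t in atTop, x t ≤ y t := hxy.mono fun _ => sub_nonpos.1
    rcases h.tendsto_y_or_tendsto_y_atTop hA0 with ⟨l₂, hy⟩ | hy
    · obtain ⟨l₁, hx⟩ := h.exists_tendsto_x_of_le hA0 hxy hy
      exact absurd (h.tendstoCollinearEquilibrium_of_tendsto hA0 hx hy) hne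
    · exact h.integrableAtFilter_enstrophyDensity_of_le hA0 hxy hy

theorem integrableAtFilter_enstrophyDensity_atBot (h : VortexTriangle a b c p q M e x y z A)
    (hA0 : ∀ᶠ t in atBot, A t ≠ 0) (hne : ¬ TendstoCollinearEquilibrium a b c x y z atBot) :
    IntegrableAtFilter (fun t => enstrophyDensity p q (x t) (y t) (z t)) atBot := by
  have hreflect := h.reflect 0
  simp only [zero_sub] at hreflect
  refine integrableAtFilter_atBot_of_comp_neg
    (hreflect.integrableAtFilter_enstrophyDensity_atTop ?_ fun hlim => hne ?_)
  · exact (tendsto_neg_atTop_atBot.eventually hA0).mono fun _ => neg_ne_zero.2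
  · obtain ⟨l₁, l₂, l₃, hx, hy, hz, hl⟩ := hlim
    have hneg {f : ℝ → ℝ} {l : ℝ} (hf : Tendsto (fun t => f (-t)) atTop (𝓝 l)) :
        Tendsto f atBot (𝓝 l) := by
      simpa only [Function.comp_def, neg_neg] using hf.comp tendsto_neg_atBot_atTop
    exact ⟨l₁, l₂, l₃, hneg hx, hneg hy, hneg hz, hl⟩

theorem subsingleton_area_eq_zero (h : VortexTriangle a b c p q M e x y z A)
    (hper : ∀ T > 0, ¬ Function.Periodic (fun t => (x t, y t, z t)) T) :
    {t | A t = 0}.Subsingleton := by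
  intro s hs s' hs'
  by_contra hne
  rcases lt_or_gt_of_ne hne with hlt | hlt
  · exact hper _ (by linarith) (h.periodic_of_area_eq_zero hs hs')
  · exact hper _ (by linarith) (h.periodic_of_area_eq_zero hs' hs)

theorem integrable_enstrophyDensity (h : VortexTriangle a b c p q M e x y z A)
    (htop : ¬ TendstoCollinearEquilibrium a b c x y z atTop)
    (hbot : ¬ TendstoCollinearEquilibrium a b c x y z atBot)
    (hper : ∀ T > 0, ¬ Function.Periodic (fun t => (x t, y t, z t)) T) :
    Integrable fun t => enstrophyDensity p q (x t) (y t) (z t) := by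
  have hA0 : ∀ᶠ t in cocompact ℝ, A t ≠ 0 :=
    (h.subsingleton_area_eq_zero hper).finite.isCompact.compl_mem_cocompact
  rw [integrable_iff_integrableAtFilter_atBot_atTop]
  exact ⟨⟨h.integrableAtFilter_enstrophyDensity_atBot (hA0.filter_mono atBot_le_cocompact) hbot,
    h.integrableAtFilter_enstrophyDensity_atTop (hA0.filter_mono atTop_le_cocompact) htop⟩,
    h.continuous_enstrophyDensity.locallyIntegrable⟩

end VortexTriangle

/-! ### Three vortices in the plane -/

theorem perp_smul (c : ℝ) (u : Plane) : perp (c • u) = c • perp u := by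
  ext i
  fin_cases i <;> simp [perp]

theorem perp_zero : perp 0 = 0 := by
  simpa using perp_smul 0 0

theorem kernel_smul_perp (γ : ℝ) (u v : Plane) :
    (γ / dist u v ^ 2 * funPK gaussianKernel (dist u v / 1)) • perp (v - u) =
      (γ * expQuotient (dist u v ^ 2)) • perp (v - u) := by
  rcases eq_or_ne u v with rfl | huv
  · rw [sub_self, perp_zero, smul_zero, smul_zero]
  · have hdist : 0 < dist u v := dist_pos.2 huv
    rw [div_one, funPK_gaussianKernel hdist]
    congr 1
    field_simp

theorem isSolution_one_iff {N : ℕ} {Γ : Fin N → ℝ} {X : Fin N → ℝ → Plane} :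
    IsSolution gaussianKernel 1 Γ X ↔ ∀ n t, HasDerivAt (X n) (-(1 / (2 * Real.pi)) •
      ∑ m, (Γ m * expQuotient (dist (X m t) (X n t) ^ 2)) • perp (X n t - X m t)) t := by
  refine forall_congr' fun n => forall_congr' fun t => ?_
  simp only [kernel_smul_perp]
  rw [Finset.sum_erase]
  rw [sub_self, perp_zero, smul_zero]

theorem IsSolution.comp_perm {h : Plane → ℝ} {ε : ℝ} {N : ℕ} {Γ : Fin N → ℝ}
    {X : Fin N → ℝ → Plane} (hX : IsSolution h ε Γ X) (σ : Equiv.Perm (Fin N)) :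
    IsSolution h ε (Γ ∘ σ) (X ∘ σ) := by
  intro n t
  have hsum := Finset.sum_equiv σ (s := Finset.univ.erase n) (t := Finset.univ.erase (σ n))
    (f := fun m => (Γ (σ m) / dist (X (σ m) t) (X (σ n) t) ^ 2 *
      funPK h (dist (X (σ m) t) (X (σ n) t) / ε)) • perp (X (σ n) t - X (σ m) t))
    (g := fun m => (Γ m / dist (X m t) (X (σ n) t) ^ 2 *
      funPK h (dist (X m t) (X (σ n) t) / ε)) • perp (X (σ n) t - X m t))
    (by simp) fun _ _ => rfl
  exact hsum ▸ hX (σ n) t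

theorem dist_sq_plane (u v : Plane) : dist u v ^ 2 = (u 0 - v 0) ^ 2 + (u 1 - v 1) ^ 2 := by
  rw [EuclideanSpace.dist_sq_eq, Fin.sum_univ_two, Real.dist_eq, Real.dist_eq, sq_abs, sq_abs]

theorem sum_pairs_fin_three (f : Fin 3 → Fin 3 → ℝ) :
    ∑ n, ∑ m ∈ Finset.Ioi n, f n m = f 0 1 + f 0 2 + f 1 2 := by
  have h0 : Finset.Ioi (0 : Fin 3) = {1, 2} := by decide
  have h1 : Finset.Ioi (1 : Fin 3) = {2} := by decide
  have h2 : Finset.Ioi (2 : Fin 3) = ∅ := by decide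
  rw [Fin.sum_univ_three, h0, h1, h2, Finset.sum_pair (by decide), Finset.sum_singleton,
    Finset.sum_empty, add_zero]

theorem third_circulation_eq {a b c : ℝ} (ha : 0 < a) (hb : 0 < b)
    (hsum : 1 / a + 1 / b + 1 / c = 0) : c = -(a * b / (a + b)) := by
  have hc : c⁻¹ = -((a + b) / (a * b)) := by
    rw [← one_div, eq_neg_of_add_eq_zero_right hsum, one_div_add_one_div ha.ne' hb.ne']
  rw [← inv_inv c, hc, inv_neg, inv_div]

theorem weighted_difference_conserved {a b c p q : ℝ} {f f' x y z A : ℝ → ℝ}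
    (hf : ∀ u, HasDerivAt f (f' u) u)
    (hcyclic : ∀ u v w, f' u * (expQuotient v - expQuotient w) +
      f' v * (expQuotient w - expQuotient u) + f' w * (expQuotient u - expQuotient v) = 0)
    (hx : ∀ t, HasDerivAt x (a / Real.pi * A t * (expQuotient (y t) - expQuotient (z t))) t)
    (hy : ∀ t, HasDerivAt y (b / Real.pi * A t * (expQuotient (z t) - expQuotient (x t))) t)
    (hz : ∀ t, HasDerivAt z (c / Real.pi * A t * (expQuotient (x t) - expQuotient (y t))) t)
    (hap : a * p = -c) (hbq : b * q = -c) (s t : ℝ) :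
    p * f (x s) + q * f (y s) - f (z s) = p * f (x t) + q * f (y t) - f (z t) := by
  have hderiv (t : ℝ) : HasDerivAt (fun t => p * f (x t) + q * f (y t) - f (z t)) 0 t := by
    refine (((((hf _).comp t (hx t)).const_mul p).add
      (((hf _).comp t (hy t)).const_mul q)).sub ((hf _).comp t (hz t))).congr_deriv ?_
    linear_combination
      f' (x t) * (A t / Real.pi) * (expQuotient (y t) - expQuotient (z t)) * hap +
      f' (y t) * (A t / Real.pi) * (expQuotient (z t) - expQuotient (x t)) * hbq -
      c * (A t / Real.pi) * hcyclic (x t) (y t) (z t)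
  exact is_const_of_deriv_eq_zero (fun t => (hderiv t).differentiableAt)
    (fun t => (hderiv t).deriv) s t

section ThreeVortices

variable {Γ : Fin 3 → ℝ} {X : Fin 3 → ℝ → Plane}

/-- Twice the oriented area of the triangle of three vortices. -/
def orientedArea (X : Fin 3 → ℝ → Plane) (t : ℝ) : ℝ :=
  (X 1 t 0 - X 2 t 0) * (X 2 t 1 - X 0 t 1) - (X 1 t 1 - X 2 t 1) * (X 2 t 0 - X 0 t 0)

theorem orientedArea_comp_finRotate (X : Fin 3 → ℝ → Plane) :
    orientedArea (X ∘ finRotate 3) = orientedArea X := by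
  funext t
  change (X 2 t 0 - X 0 t 0) * (X 0 t 1 - X 1 t 1) - (X 2 t 1 - X 0 t 1) * (X 0 t 0 - X 1 t 0) = _
  rw [orientedArea]
  ring

theorem heron_orientedArea (X : Fin 3 → ℝ → Plane) (t : ℝ) :
    4 * orientedArea X t ^ 2 = 4 * dist (X 1 t) (X 2 t) ^ 2 * dist (X 2 t) (X 0 t) ^ 2 -
      (dist (X 0 t) (X 1 t) ^ 2 - dist (X 1 t) (X 2 t) ^ 2 - dist (X 2 t) (X 0 t) ^ 2) ^ 2 := by
  simp only [dist_sq_plane, orientedArea]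
  ring

theorem hasDerivAt_coordinates (hX : IsSolution gaussianKernel 1 Γ X) (n : Fin 3) (t : ℝ) :
    HasDerivAt (fun t => X n t 0) (-(1 / (2 * Real.pi)) *
      ∑ m, Γ m * expQuotient (dist (X m t) (X n t) ^ 2) * (X n t 1 - X m t 1)) t ∧
    HasDerivAt (fun t => X n t 1) (1 / (2 * Real.pi) *
      ∑ m, Γ m * expQuotient (dist (X m t) (X n t) ^ 2) * (X n t 0 - X m t 0)) t := by
  have hcoord (i : Fin 2) := ((EuclideanSpace.proj (𝕜 := ℝ) i :
    Plane →L[ℝ] ℝ).hasFDerivAt (x := X n t)).comp_hasDerivAt t (isSolution_one_iff.1 hX n t)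
  refine ⟨(hcoord 0).congr_deriv ?_, (hcoord 1).congr_deriv ?_⟩
  · simp [perp]
  · simp [perp, -neg_sub, Finset.mul_sum]

theorem hasDerivAt_dist_sq (hX : IsSolution gaussianKernel 1 Γ X) (t : ℝ) :
    HasDerivAt (fun t => dist (X 1 t) (X 2 t) ^ 2) (Γ 0 / Real.pi * orientedArea X t *
      (expQuotient (dist (X 2 t) (X 0 t) ^ 2) - expQuotient (dist (X 0 t) (X 1 t) ^ 2))) t := by
  obtain ⟨h10, h11⟩ := hasDerivAt_coordinates hX 1 t
  obtain ⟨h20, h21⟩ := hasDerivAt_coordinates hX 2 t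
  simp only [dist_sq_plane (X 1 _) (X 2 _)]
  refine (((h10.sub h20).pow 2).add ((h11.sub h21).pow 2)).congr_deriv ?_
  simp only [Fin.sum_univ_three, sub_self, orientedArea, Pi.sub_apply]
  rw [dist_comm (X 2 t) (X 1 t), dist_comm (X 0 t) (X 2 t)]
  ring

theorem hasDerivAt_orientedArea (hX : IsSolution gaussianKernel 1 Γ X) (t : ℝ) :
    HasDerivAt (orientedArea X) (areaRate (Γ 0) (Γ 1) (Γ 2) (dist (X 1 t) (X 2 t) ^ 2)
      (dist (X 2 t) (X 0 t) ^ 2) (dist (X 0 t) (X 1 t) ^ 2)) t := by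
  obtain ⟨h00, h01⟩ := hasDerivAt_coordinates hX 0 t
  obtain ⟨h10, h11⟩ := hasDerivAt_coordinates hX 1 t
  obtain ⟨h20, h21⟩ := hasDerivAt_coordinates hX 2 t
  refine (((h10.sub h20).mul (h21.sub h01)).sub ((h11.sub h21).mul (h20.sub h00))).congr_deriv ?_
  simp only [Fin.sum_univ_three, sub_self, Pi.sub_apply, areaRate]
  rw [dist_comm (X 2 t) (X 1 t), dist_comm (X 0 t) (X 2 t), dist_comm (X 1 t) (X 0 t)]
  generalize expQuotient (dist (X 1 t) (X 2 t) ^ 2) = E₀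
  generalize expQuotient (dist (X 2 t) (X 0 t) ^ 2) = E₁
  generalize expQuotient (dist (X 0 t) (X 1 t) ^ 2) = E₂
  simp only [dist_sq_plane]
  ring

theorem hamiltonian_gaussianKernel {p q : ℝ} (X : Fin 3 → Plane) (hap : Γ 0 * p = -Γ 2)
    (hbq : Γ 1 * q = -Γ 2) (hpq : p + q = 1) :
    hamiltonian gaussianKernel Γ X = Γ 0 * Γ 1 / (4 * Real.pi) *
      (p * entireExpIntegral (dist (X 1) (X 2) ^ 2) +
        q * entireExpIntegral (dist (X 2) (X 0) ^ 2) -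
        entireExpIntegral (dist (X 0) (X 1) ^ 2)) := by
  rw [hamiltonian, sum_pairs_fin_three]
  simp only [funHP_gaussianKernel (sq_nonneg _)]
  rw [dist_comm (X 1) (X 0), dist_comm (X 2) (X 1)]
  set C := ∫ u in Ioi 0, Real.exp (-u) * Real.log u
  set E := entireExpIntegral
  linear_combination -(1 / (4 * Real.pi)) *
    (Γ 1 * (C + E (dist (X 1) (X 2) ^ 2)) * hap + Γ 0 * (C + E (dist (X 2) (X 0) ^ 2)) * hbq -
      C * Γ 0 * Γ 1 * hpq)

theorem scaledEnstrophy_gaussianKernel {p q : ℝ} (X : Fin 3 → ℝ → Plane) (hap : Γ 0 * p = -Γ 2)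
    (hbq : Γ 1 * q = -Γ 2) (t : ℝ) :
    scaledEnstrophy gaussianKernel Γ X t = Γ 0 * Γ 1 / (2 * Real.pi) *
      enstrophyDensity p q (dist (X 1 t) (X 2 t) ^ 2) (dist (X 2 t) (X 0 t) ^ 2)
        (dist (X 0 t) (X 1 t) ^ 2) := by
  rw [scaledEnstrophy, sum_pairs_fin_three, enstrophyDensity]
  simp only [enstrophyIntegral_gaussianKernel]
  rw [dist_comm (X 1 t) (X 0 t), dist_comm (X 2 t) (X 1 t)]
  linear_combination -(1 / (2 * Real.pi)) *
    (Γ 1 * Real.exp (-dist (X 1 t) (X 2 t) ^ 2 / 2) * hap +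
      Γ 0 * Real.exp (-dist (X 2 t) (X 0 t) ^ 2 / 2) * hbq)

theorem IsSolution.vortexTriangle (hX : IsSolution gaussianKernel 1 Γ X) (h0 : 0 < Γ 0)
    (h1 : 0 < Γ 1) (hsum : 1 / Γ 0 + 1 / Γ 1 + 1 / Γ 2 = 0)
    (hH : hamiltonian gaussianKernel Γ (fun n => X n 0) < 0) :
    ∃ M e, VortexTriangle (Γ 0) (Γ 1) (Γ 2) (Γ 1 / (Γ 0 + Γ 1)) (Γ 0 / (Γ 0 + Γ 1)) M e
      (fun t => dist (X 1 t) (X 2 t) ^ 2) (fun t => dist (X 2 t) (X 0 t) ^ 2)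
      (fun t => dist (X 0 t) (X 1 t) ^ 2) (orientedArea X) := by
  have hΓ := third_circulation_eq h0 h1 hsum
  have hap : Γ 0 * (Γ 1 / (Γ 0 + Γ 1)) = -Γ 2 := by rw [hΓ]; ring
  have hbq : Γ 1 * (Γ 0 / (Γ 0 + Γ 1)) = -Γ 2 := by rw [hΓ]; ring
  have hpq : Γ 1 / (Γ 0 + Γ 1) + Γ 0 / (Γ 0 + Γ 1) = 1 := by
    rw [← add_div, add_comm, div_self (by positivity)]
  have hx := hasDerivAt_dist_sq hX
  have hy (t : ℝ) := hasDerivAt_dist_sq (hX.comp_perm (finRotate 3)) t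
  have hz (t : ℝ) := hasDerivAt_dist_sq ((hX.comp_perm (finRotate 3)).comp_perm (finRotate 3)) t
  simp only [orientedArea_comp_finRotate] at hy hz
  have hmoment := weighted_difference_conserved hasDerivAt_id
    (fun u v w => by ring) hx hy hz hap hbq
  have henergy := weighted_difference_conserved hasDerivAt_entireExpIntegral
    (fun u v w => by ring) hx hy hz hap hbq
  refine ⟨_, _, hx, hy, hz, hasDerivAt_orientedArea hX, fun t => sq_nonneg _, fun t => sq_nonneg _,
    fun t => sq_nonneg _, heron_orientedArea X, fun t => hmoment t 0, fun t => henergy t 0,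
    by positivity, by positivity, hpq, ?_, hap, hbq, ?_⟩
  · rw [hΓ, neg_lt_zero]
    positivity
  · rw [hamiltonian_gaussianKernel _ hap hbq hpq] at hH
    exact (pos_iff_neg_of_mul_neg hH).1 (by positivity)

end ThreeVortices

/-! ### Collinear relative equilibria -/

/-- The unit vector at angle `w * t`. -/
def direction (w t : ℝ) : Plane := !₂[Real.cos (w * t), Real.sin (w * t)]

theorem norm_direction (w t : ℝ) : ‖direction w t‖ = 1 := by
  simp [direction, EuclideanSpace.norm_eq]

theorem hasDerivAt_direction (w t : ℝ) :
    HasDerivAt (direction w) (-w • perp (direction w t)) t := by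
  have hlin : HasDerivAt (fun t => w * t) w t := hasDerivAt_const_mul w
  have hcoord : HasDerivAt (fun t => ![Real.cos (w * t), Real.sin (w * t)])
      ![-Real.sin (w * t) * w, Real.cos (w * t) * w] t := by
    rw [hasDerivAt_pi, Fin.forall_fin_two]
    exact ⟨hlin.cos, hlin.sin⟩
  refine ((PiLp.hasFDerivAt_toLp 2 _).comp_hasDerivAt t hcoord).congr_deriv ?_
  ext i
  fin_cases i <;> simp [direction, perp, mul_comm]

theorem continuous_perp_direction (w : ℝ) : Continuous fun t => perp (direction w t) := by
  unfold direction perp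
  fun_prop

/-- The rigid motion of points with coordinates `y n` on a line that rotates with angular velocity
`w` and drifts orthogonally to itself with speed `β`. It also covers the translations, `w = 0`. -/
def rigidMotion {N : ℕ} (w β : ℝ) (y : Fin N → ℝ) (n : Fin N) (t : ℝ) : Plane :=
  y n • direction w t - β • ∫ s in (0 : ℝ)..t, perp (direction w s)

/-- The velocity, orthogonal to the line, of the `n`-th of finitely many regularized vortices with
coordinates `y` on a line. -/
def lineVelocity {N : ℕ} (Γ y : Fin N → ℝ) (n : Fin N) : ℝ :=
  1 / (2 * Real.pi) * ∑ m, Γ m * expQuotient ((y m - y n) ^ 2) * (y n - y m)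

theorem rigidMotion_sub_rigidMotion {N : ℕ} (w β : ℝ) (y : Fin N → ℝ) (m n : Fin N) (t : ℝ) :
    rigidMotion w β y m t - rigidMotion w β y n t = (y m - y n) • direction w t := by
  rw [rigidMotion, rigidMotion, sub_sub_sub_cancel_right, sub_smul]

theorem dist_rigidMotion {N : ℕ} (w β : ℝ) (y : Fin N → ℝ) (m n : Fin N) (t : ℝ) :
    dist (rigidMotion w β y m t) (rigidMotion w β y n t) = |y m - y n| := by
  rw [dist_eq_norm, rigidMotion_sub_rigidMotion, norm_smul, norm_direction, mul_one,
    Real.norm_eq_abs]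

theorem isSolution_rigidMotion {N : ℕ} {Γ : Fin N → ℝ} {w β : ℝ} {y : Fin N → ℝ}
    (h : ∀ n, lineVelocity Γ y n = w * y n + β) :
    IsSolution gaussianKernel 1 Γ (rigidMotion w β y) := by
  rw [isSolution_one_iff]
  intro n t
  have hdrift : HasDerivAt (fun t => ∫ s in (0 : ℝ)..t, perp (direction w s))
      (perp (direction w t)) t := (continuous_perp_direction w).integral_hasStrictDerivAt 0 t
      |>.hasDerivAt
  refine (((hasDerivAt_direction w t).const_smul (y n)).sub
    (hdrift.const_smul β)).congr_deriv ?_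
  simp only [dist_rigidMotion, sq_abs, rigidMotion_sub_rigidMotion, perp_smul, smul_smul]
  rw [← Finset.sum_smul, smul_smul, ← sub_smul, neg_mul, ← lineVelocity, h]
  congr 1
  ring

theorem areaRate_collinear (Γ y : Fin 3 → ℝ) :
    areaRate (Γ 0) (Γ 1) (Γ 2) ((y 1 - y 2) ^ 2) ((y 2 - y 0) ^ 2) ((y 0 - y 1) ^ 2) =
      (y 1 - y 2) * (lineVelocity Γ y 2 - lineVelocity Γ y 0) -
        (lineVelocity Γ y 1 - lineVelocity Γ y 2) * (y 2 - y 0) := by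
  simp only [areaRate, lineVelocity, Fin.sum_univ_three]
  rw [sub_sq_comm (y 2) (y 1), sub_sq_comm (y 0) (y 2), sub_sq_comm (y 1) (y 0)]
  ring

theorem exists_coordinates_of_degenerate_triangle {x y z : ℝ} (hx : 0 ≤ x) (hy : 0 ≤ y)
    (h : 4 * x * y = (z - x - y) ^ 2) :
    ∃ u : Fin 3 → ℝ, (u 1 - u 2) ^ 2 = x ∧ (u 2 - u 0) ^ 2 = y ∧ (u 0 - u 1) ^ 2 = z := by
  obtain ⟨d₁, rfl⟩ : ∃ d, d ^ 2 = x := ⟨√x, Real.sq_sqrt hx⟩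
  obtain ⟨d₂, rfl⟩ : ∃ d, d ^ 2 = y := ⟨√y, Real.sq_sqrt hy⟩
  have hsq : (2 * d₁ * d₂) ^ 2 = (z - d₁ ^ 2 - d₂ ^ 2) ^ 2 := by linear_combination h
  rcases sq_eq_sq_iff_eq_or_eq_neg.1 hsq with h | h
  · refine ⟨![-d₂, d₁, 0], ?_⟩
    simp only [Matrix.cons_val_zero, Matrix.cons_val_one, Matrix.cons_val, sub_zero,
      sub_neg_eq_add, zero_add, true_and]
    linear_combination h
  · refine ⟨![d₂, d₁, 0], ?_⟩
    simp only [Matrix.cons_val_zero, Matrix.cons_val_one, Matrix.cons_val, sub_zero, zero_sub,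
      neg_sq, true_and]
    linear_combination -h

theorem exists_eq_mul_of_mul_eq_mul {d₁ d₂ v₁ v₂ : ℝ} (h : d₁ * v₂ = v₁ * d₂)
    (hd : d₁ ≠ 0 ∨ d₂ ≠ 0) : ∃ w, v₁ = w * d₁ ∧ v₂ = w * d₂ := by
  rcases hd with hd | hd
  · exact ⟨v₁ / d₁, by field_simp, by field_simp; linarith⟩
  · exact ⟨v₂ / d₂, by field_simp; linarith, by field_simp⟩

theorem IsCollinearEquilibrium.exists_relativeEquilibrium {Γ : Fin 3 → ℝ} {x y z : ℝ}
    (h : IsCollinearEquilibrium (Γ 0) (Γ 1) (Γ 2) x y z) :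
    ∃ Y : Fin 3 → ℝ → Plane, IsSolution gaussianKernel 1 Γ Y ∧
      (∀ m n t, dist (Y m t) (Y n t) = dist (Y m 0) (Y n 0)) ∧
      dist (Y 1 0) (Y 2 0) ^ 2 = x ∧ dist (Y 2 0) (Y 0 0) ^ 2 = y ∧
      dist (Y 0 0) (Y 1 0) ^ 2 = z := by
  obtain ⟨u, rfl, rfl, rfl⟩ := exists_coordinates_of_degenerate_triangle h.x_nonneg h.y_nonneg
    h.heron
  have hrate := h.areaRate_eq_zero
  rw [areaRate_collinear, sub_eq_zero] at hrate
  obtain ⟨w, h12, h20⟩ := exists_eq_mul_of_mul_eq_mul hrate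
    (h.ne_zero.imp (by simp) (by simp))
  have hvelocity (n : Fin 3) :
      lineVelocity Γ u n = w * u n + (lineVelocity Γ u 2 - w * u 2) :=
    match n with
    | 0 => by linear_combination -h20
    | 1 => by linear_combination h12
    | 2 => by ring
  refine ⟨_, isSolution_rigidMotion hvelocity, fun m n t => ?_, ?_⟩
  · rw [dist_rigidMotion, dist_rigidMotion]
  · simp only [dist_rigidMotion, sq_abs, and_self]

theorem forall_fin_three_of_symm {P : Fin 3 → Fin 3 → Prop} (hsymm : ∀ m n, P m n → P n m)
    (hrefl : ∀ n, P n n) (h12 : P 1 2) (h20 : P 2 0) (h01 : P 0 1) (m n : Fin 3) : P m n := by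
  fin_cases m <;> fin_cases n
  exacts [hrefl 0, h01, hsymm _ _ h20, hsymm _ _ h01, hrefl 1, h12, h20, hsymm _ _ h12, hrefl 2]

theorem tendsto_of_tendsto_sq {α : Type*} {l : Filter α} {f : α → ℝ} {a : ℝ} (hf : ∀ t, 0 ≤ f t)
    (ha : 0 ≤ a) (h : Tendsto (fun t => f t ^ 2) l (𝓝 (a ^ 2))) : Tendsto f l (𝓝 a) := by
  simpa only [Real.sqrt_sq (hf _), Real.sqrt_sq ha] using h.sqrt

theorem TendstoCollinearEquilibrium.convergesToRelativeEquilibrium {Γ : Fin 3 → ℝ}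
    {X : Fin 3 → ℝ → Plane} {l : Filter ℝ}
    (h : TendstoCollinearEquilibrium (Γ 0) (Γ 1) (Γ 2) (fun t => dist (X 1 t) (X 2 t) ^ 2)
      (fun t => dist (X 2 t) (X 0 t) ^ 2) (fun t => dist (X 0 t) (X 1 t) ^ 2) l) :
    ConvergesToRelativeEquilibrium gaussianKernel Γ X l := by
  obtain ⟨x, y, z, hx, hy, hz, h⟩ := h
  obtain ⟨Y, hY, hconst, rfl, rfl, rfl⟩ := h.exists_relativeEquilibrium
  have hsqrt {m n : Fin 3}
      (h : Tendsto (fun t => dist (X m t) (X n t) ^ 2) l (𝓝 (dist (Y m 0) (Y n 0) ^ 2))) :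
      Tendsto (fun t => dist (X m t) (X n t)) l (𝓝 (dist (Y m 0) (Y n 0))) :=
    tendsto_of_tendsto_sq (fun _ => dist_nonneg) dist_nonneg h
  refine ⟨Y, hY, hconst, forall_fin_three_of_symm (fun m n h => ?_) (fun n => ?_) (hsqrt hx)
    (hsqrt hy) (hsqrt hz)⟩
  · simpa only [dist_comm] using h
  · simp only [dist_self, tendsto_const_nhds]

theorem hasPeriodicDistances_of_sq {X : Fin 3 → ℝ → Plane} {T : ℝ} (hT : 0 < T)
    (h : Function.Periodic (fun t => (dist (X 1 t) (X 2 t) ^ 2, dist (X 2 t) (X 0 t) ^ 2,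
      dist (X 0 t) (X 1 t) ^ 2)) T) : HasPeriodicDistances X := by
  refine ⟨T, hT, fun m n t => ?_⟩
  have hsides := h t
  simp only [Prod.mk.injEq, sq_eq_sq₀ dist_nonneg dist_nonneg] at hsides
  obtain ⟨h12, h20, h01⟩ := hsides
  exact forall_fin_three_of_symm (P := fun m n => dist (X m (t + T)) (X n (t + T)) =
    dist (X m t) (X n t)) (fun m n h => by simpa only [dist_comm] using h)
    (fun n => by rw [dist_self, dist_self]) h12 h20 h01 m n

section Enstrophy

variable {Γ : Fin 3 → ℝ} {X : Fin 3 → ℝ → Plane}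

theorem IsSolution.scaledEnstrophy_pos (hX : IsSolution gaussianKernel 1 Γ X) (h0 : 0 < Γ 0)
    (h1 : 0 < Γ 1) (hsum : 1 / Γ 0 + 1 / Γ 1 + 1 / Γ 2 = 0)
    (hH : hamiltonian gaussianKernel Γ (fun n => X n 0) < 0) (t : ℝ) :
    0 < scaledEnstrophy gaussianKernel Γ X t := by
  obtain ⟨M, e, h⟩ := hX.vortexTriangle h0 h1 hsum hH
  rw [scaledEnstrophy_gaussianKernel X h.a_mul_p h.b_mul_q]
  exact mul_pos (by positivity) (h.enstrophyDensity_pos t)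

theorem IsSolution.integrable_scaledEnstrophy (hX : IsSolution gaussianKernel 1 Γ X)
    (h0 : 0 < Γ 0) (h1 : 0 < Γ 1) (hsum : 1 / Γ 0 + 1 / Γ 1 + 1 / Γ 2 = 0)
    (hH : hamiltonian gaussianKernel Γ (fun n => X n 0) < 0)
    (htop : ¬ ConvergesToRelativeEquilibrium gaussianKernel Γ X atTop)
    (hbot : ¬ ConvergesToRelativeEquilibrium gaussianKernel Γ X atBot)
    (hper : ¬ HasPeriodicDistances X) : Integrable (scaledEnstrophy gaussianKernel Γ X) := by
  obtain ⟨M, e, h⟩ := hX.vortexTriangle h0 h1 hsum hH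
  rw [funext (scaledEnstrophy_gaussianKernel X h.a_mul_p h.b_mul_q)]
  exact (h.integrable_enstrophyDensity (fun hl => htop hl.convergesToRelativeEquilibrium)
    (fun hl => hbot hl.convergesToRelativeEquilibrium)
    fun T hT hl => hper (hasPeriodicDistances_of_sq hT hl)).const_mul _

end Enstrophy

/-! ### Concentration under rescaling -/

section Rescaling

variable {N : ℕ} {h : Plane → ℝ} {Γ : Fin N → ℝ} {X : Fin N → ℝ → Plane} {ε : ℝ}

theorem continuous_scaledEnstrophy (hX : ∀ n, Continuous (X n)) :
    Continuous (scaledEnstrophy gaussianKernel Γ X) := by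
  unfold scaledEnstrophy
  simp only [enstrophyIntegral_gaussianKernel]
  fun_prop

theorem IsSolution.continuous (hX : IsSolution h ε Γ X) (n : Fin N) : Continuous (X n) :=
  continuous_iff_continuousAt.2 fun t => (hX n t).continuousAt

theorem dist_unscale (hε : 0 ≤ ε) (tstar : ℝ) (m n : Fin N) (t : ℝ) :
    dist (unscale ε tstar X m t) (unscale ε tstar X n t) =
      ε * dist (X m ((t - tstar) / ε ^ 2)) (X n ((t - tstar) / ε ^ 2)) := by
  rw [unscale, unscale, dist_smul₀, Real.norm_of_nonneg hε]

theorem isSolution_unscale (hX : IsSolution h 1 Γ X) (hε : 0 < ε) (tstar : ℝ) :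
    IsSolution h ε Γ (unscale ε tstar X) := by
  intro n t
  have htime : HasDerivAt (fun t : ℝ => (t - tstar) / ε ^ 2) (1 / ε ^ 2) t :=
    ((hasDerivAt_id t).sub_const tstar).div_const _
  refine ((HasDerivAt.scomp t (hX n _) htime).const_smul ε).congr_deriv ?_
  simp only [dist_unscale hε.le, mul_div_cancel_left₀ _ hε.ne', div_one]
  simp only [unscale, ← smul_sub, perp_smul, smul_smul, Finset.smul_sum]
  refine Finset.sum_congr rfl fun m _ => congrArg (· • _) ?_
  rw [mul_pow, div_mul_eq_div_div]
  field_simp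

theorem enstrophyVariation_unscale (hε : 0 < ε) (tstar t : ℝ) :
    enstrophyVariation h ε Γ (unscale ε tstar X) t =
      -(1 / ε ^ 2) * scaledEnstrophy h Γ X ((t - tstar) / ε ^ 2) := by
  unfold enstrophyVariation scaledEnstrophy
  simp only [dist_unscale hε.le, mul_div_cancel_left₀ _ hε.ne']
  field_simp

theorem continuous_enstrophyVariation_unscale (hX : Continuous (scaledEnstrophy h Γ X))
    (hε : 0 < ε) (tstar : ℝ) :
    Continuous (enstrophyVariation h ε Γ (unscale ε tstar X)) := by
  rw [funext (enstrophyVariation_unscale hε tstar)]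
  fun_prop

theorem tendsto_dist_unscale_zero (X : Fin N → ℝ → Plane) (tstar : ℝ) (m n : Fin N) :
    Tendsto (fun ε : ℝ => dist (unscale ε tstar X m tstar) (unscale ε tstar X n tstar))
      (𝓝[>] 0) (𝓝 0) := by
  have hlim : Tendsto (fun ε : ℝ => ε * dist (X m 0) (X n 0)) (𝓝[>] 0) (𝓝 0) :=
    (zero_mul (dist (X m 0) (X n 0)) ▸ (continuous_mul_const _).tendsto 0).mono_left
      nhdsWithin_le_nhds
  refine hlim.congr' ?_
  filter_upwards [self_mem_nhdsWithin] with ε hε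
  rw [dist_unscale (le_of_lt hε), sub_self, zero_div]

theorem integral_comp_sub_div_smul {E : Type*} [NormedAddCommGroup E] [NormedSpace ℝ E]
    (f : ℝ → ℝ) (g : ℝ → E) {r : ℝ} (hr : 0 < r) (s : ℝ) :
    ∫ t, (1 / r * f ((t - s) / r)) • g t = ∫ τ, f τ • g (s + r * τ) := by
  have hshift := integral_sub_right_eq_self (μ := volume)
    (fun t => (1 / r * f (t / r)) • g (s + t)) s
  have hdilate := Measure.integral_comp_div (fun τ => (1 / r * f τ) • g (s + r * τ)) r
  simp only [add_sub_cancel] at hshift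
  simp only [mul_div_cancel₀ _ hr.ne'] at hdilate
  rw [hshift, hdilate, abs_of_pos hr, ← integral_smul]
  congr! 2 with τ
  rw [smul_smul]
  congr 1
  field_simp

theorem tendsto_integral_comp_sub_div_smul {E : Type*} [NormedAddCommGroup E] [NormedSpace ℝ E]
    [CompleteSpace E] {f : ℝ → ℝ} {g : ℝ → E} {C : ℝ} (hf : Integrable f) (hg : Continuous g)
    (hC : ∀ t, ‖g t‖ ≤ C) (s : ℝ) :
    Tendsto (fun r : ℝ => ∫ t, (1 / r * f ((t - s) / r)) • g t) (𝓝[>] 0)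
      (𝓝 ((∫ t, f t) • g s)) := by
  have hlim : Tendsto (fun r : ℝ => ∫ τ, f τ • g (s + r * τ)) (𝓝[>] 0) (𝓝 ((∫ t, f t) • g s)) := by
    rw [← integral_smul_const]
    refine tendsto_integral_filter_of_dominated_convergence (fun τ => ‖f τ‖ * C)
      (.of_forall fun r => hf.aestronglyMeasurable.smul
        (by fun_prop : Continuous fun τ => g (s + r * τ)).aestronglyMeasurable)
      (.of_forall fun r => .of_forall fun τ => ?_) (hf.norm.mul_const C)
      (.of_forall fun τ => tendsto_nhdsWithin_of_tendsto_nhds ?_)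
    · rw [norm_smul]
      gcongr
      exact hC _
    · have hcont : Continuous fun r => f τ • g (s + r * τ) := by fun_prop
      simpa only [zero_mul, add_zero] using hcont.tendsto 0
  refine hlim.congr' ?_
  filter_upwards [self_mem_nhdsWithin] with r hr
  exact (integral_comp_sub_div_smul f g hr s).symm

theorem tendsto_integral_enstrophyVariation_unscale {φ : ℝ → ℝ} {C : ℝ}
    (hX : Integrable (scaledEnstrophy h Γ X)) (hφ : Continuous φ) (hC : ∀ t, ‖φ t‖ ≤ C)
    (tstar : ℝ) :
    Tendsto (fun ε : ℝ => ∫ t, enstrophyVariation h ε Γ (unscale ε tstar X) t * φ t) (𝓝[>] 0)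
      (𝓝 (-enstrophyMass h Γ X * φ tstar)) := by
  have hsq : Tendsto (fun ε : ℝ => ε ^ 2) (𝓝[>] 0) (𝓝[>] 0) := by
    refine tendsto_nhdsWithin_iff.2 ⟨?_, ?_⟩
    · simpa using ((continuous_pow 2).tendsto (0 : ℝ)).mono_left nhdsWithin_le_nhds
    · filter_upwards [self_mem_nhdsWithin] with ε hε using mem_Ioi.2 (pow_pos (mem_Ioi.1 hε) 2)
  rw [neg_mul]
  refine ((tendsto_integral_comp_sub_div_smul hX hφ hC tstar).comp hsq).neg.congr' ?_
  filter_upwards [self_mem_nhdsWithin] with ε hε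
  simp only [Function.comp_def, enstrophyVariation_unscale hε, neg_mul, smul_eq_mul, integral_neg]

end Rescaling

end EulerPoincare

end

theorem mainTheorem5_general :
    SmoothingHypotheses gaussianKernel ∧
    (∀ r : ℝ, 0 ≤ r →
      IntegrableOn (enstrophyIntegrand gaussianKernel (Real.sqrt r)) (Ioi 0) ∧
      funZ gaussianKernel r = Real.exp (-r / 2)) ∧
    (∀ x : Plane,
      1 / (2 * Real.pi) * funZ gaussianKernel (‖x‖ ^ 2)
        = ∫ y, gaussianKernel (x - y) * gaussianKernel y ∧
      ∫ y, gaussianKernel (x - y) * gaussianKernel y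
        = Real.exp (-‖x‖ ^ 2 / 2) / (2 * Real.pi)) ∧
    StrictAntiOn (funZ gaussianKernel) (Ici 0) ∧
    StrictConvexOn ℝ (Ici 0) (funZ gaussianKernel) ∧
    ContDiffOn ℝ 2 (funZ gaussianKernel) (Ioi 0) ∧
    ContDiffOn ℝ 2 (funHP gaussianKernel) (Ioi 0) ∧
    (∀ r : ℝ, 0 < r →
      0 < deriv (deriv (funZ gaussianKernel)) r * deriv (funHP gaussianKernel) r
        - deriv (funZ gaussianKernel) r * deriv (deriv (funHP gaussianKernel)) r) ∧
    ∀ (Γ : Fin 3 → ℝ) (X : Fin 3 → ℝ → Plane),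
      0 < Γ 0 → 0 < Γ 1 → 1 / Γ 0 + 1 / Γ 1 + 1 / Γ 2 = 0 →
      IsSolution gaussianKernel 1 Γ X →
      hamiltonian gaussianKernel Γ (fun n => X n 0) < 0 →
      ¬ ConvergesToRelativeEquilibrium gaussianKernel Γ X atTop →
      ¬ ConvergesToRelativeEquilibrium gaussianKernel Γ X atBot →
      ¬ HasPeriodicDistances X →
      Integrable (scaledEnstrophy gaussianKernel Γ X) ∧
      0 < enstrophyMass gaussianKernel Γ X ∧
      ∀ tstar : ℝ,
        (∀ ε : ℝ, 0 < ε → IsSolution gaussianKernel ε Γ (unscale ε tstar X) ∧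
          Continuous (enstrophyVariation gaussianKernel ε Γ (unscale ε tstar X))) ∧
        (∀ m n, Tendsto
          (fun ε : ℝ => dist (unscale ε tstar X m tstar) (unscale ε tstar X n tstar))
          (𝓝[>] 0) (𝓝 0)) ∧
        ∀ φ : ℝ → ℝ, Continuous φ → (∃ C, ∀ t, ‖φ t‖ ≤ C) →
          Tendsto
            (fun ε : ℝ =>
              ∫ t, enstrophyVariation gaussianKernel ε Γ (unscale ε tstar X) t * φ t)
            (𝓝[>] 0) (𝓝 (-enstrophyMass gaussianKernel Γ X * φ tstar)) := by
  refine ⟨smoothingHypotheses_gaussianKernel,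
    fun r hr => ⟨integrableOn_enstrophyIntegrand_gaussianKernel _, funZ_gaussianKernel hr⟩,
    fun x => ⟨?_, convolution_gaussianKernel x⟩,
    strictAntiOn_funZ_gaussianKernel, strictConvexOn_funZ_gaussianKernel,
    contDiffOn_funZ_gaussianKernel, contDiffOn_funHP_gaussianKernel.of_le ENat.LEInfty.out,
    fun r hr => wronskian_funZ_funHP_pos hr, fun Γ X h0 h1 hsum hX hH htop hbot hper => ?_⟩
  · rw [convolution_gaussianKernel, funZ_gaussianKernel (sq_nonneg _)]
    ring
  have hcont := continuous_scaledEnstrophy (Γ := Γ) hX.continuous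
  have hint := hX.integrable_scaledEnstrophy h0 h1 hsum hH htop hbot hper
  have hpos := hX.scaledEnstrophy_pos h0 h1 hsum hH
  refine ⟨hint, integral_pos_of_integrable_nonneg_nonzero hcont hint (fun t => (hpos t).le)
    (hpos 0).ne', fun tstar => ⟨fun ε hε => ⟨isSolution_unscale hX hε tstar,
      continuous_enstrophyVariation_unscale hcont hε tstar⟩,
    tendsto_dist_unscale_zero X tstar, fun φ hφ hbound => ?_⟩⟩
  obtain ⟨C, hC⟩ := hbound
  exact tendsto_integral_enstrophyVariation_unscale hint hφ hC tstar

theorem mainTheorem5 :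
    SmoothingHypotheses gaussianKernel ∧
    (∀ r : ℝ, 0 ≤ r →
      IntegrableOn (enstrophyIntegrand gaussianKernel (Real.sqrt r)) (Ioi 0) ∧
      funZ gaussianKernel r = Real.exp (-r / 2)) ∧
    (∀ x : Plane,
      1 / (2 * Real.pi) * funZ gaussianKernel (‖x‖ ^ 2)
        = ∫ y, gaussianKernel (x - y) * gaussianKernel y ∧
      ∫ y, gaussianKernel (x - y) * gaussianKernel y
        = Real.exp (-‖x‖ ^ 2 / 2) / (2 * Real.pi)) ∧
    StrictAntiOn (funZ gaussianKernel) (Ici 0) ∧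
    StrictConvexOn ℝ (Ici 0) (funZ gaussianKernel) ∧
    ContDiffOn ℝ 2 (funZ gaussianKernel) (Ioi 0) ∧
    ContDiffOn ℝ 2 (funHP gaussianKernel) (Ioi 0) ∧
    (∀ r : ℝ, 0 < r →
      0 < deriv (deriv (funZ gaussianKernel)) r * deriv (funHP gaussianKernel) r
        - deriv (funZ gaussianKernel) r * deriv (deriv (funHP gaussianKernel)) r) ∧
    ∀ (Γ : Fin 3 → ℝ) (Hc : ℝ) (X : Fin 3 → ℝ → Plane),
      Γ 1 ≤ Γ 0 → 0 < Γ 1 → Γ 2 < 0 → 1 / Γ 0 + 1 / Γ 1 + 1 / Γ 2 = 0 →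
      hamiltonianLowerBound (Γ 0) (Γ 1) < Hc → Hc < 0 →
      IsSolution gaussianKernel 1 Γ X →
      (∀ m n, m ≠ n → X m 0 ≠ X n 0) →
      hamiltonian gaussianKernel Γ (fun n => X n 0) = Hc →
      ¬ ConvergesToRelativeEquilibrium gaussianKernel Γ X atTop →
      ¬ ConvergesToRelativeEquilibrium gaussianKernel Γ X atBot →
      ¬ HasPeriodicDistances X →
      Integrable (scaledEnstrophy gaussianKernel Γ X) ∧
      0 < enstrophyMass gaussianKernel Γ X ∧
      ∀ tstar : ℝ,
        (∀ ε : ℝ, 0 < ε → IsSolution gaussianKernel ε Γ (unscale ε tstar X) ∧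
          Continuous (enstrophyVariation gaussianKernel ε Γ (unscale ε tstar X))) ∧
        (∀ m n, Tendsto
          (fun ε : ℝ => dist (unscale ε tstar X m tstar) (unscale ε tstar X n tstar))
          (𝓝[>] 0) (𝓝 0)) ∧
        ∀ φ : ℝ → ℝ, ContDiff ℝ ∞ φ → HasCompactSupport φ →
          Tendsto
            (fun ε : ℝ =>
              ∫ t, enstrophyVariation gaussianKernel ε Γ (unscale ε tstar X) t * φ t)
            (𝓝[>] 0) (𝓝 (-enstrophyMass gaussianKernel Γ X * φ tstar)) := by
  obtain ⟨h₁, h₂, h₃, h₄, h₅, h₆, h₇, h₈, hdissipation⟩ := mainTheorem5_general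
  refine ⟨h₁, h₂, h₃, h₄, h₅, h₆, h₇, h₈,
    fun Γ Hc X hle h1 _ hsum _ hHc hX _ hH htop hbot hper => ?_⟩
  obtain ⟨hint, hmass, hlim⟩ :=
    hdissipation Γ X (h1.trans_le hle) h1 hsum hX (hH.trans_lt hHc) htop hbot hper
  exact ⟨hint, hmass, fun tstar => ⟨(hlim tstar).1, (hlim tstar).2.1, fun φ hφ hc =>
    (hlim tstar).2.2 φ hφ.continuous (hc.exists_bound_of_continuous hφ.continuous)⟩⟩
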